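/- **Setting.** Let $N\ge 1$, let $\mathscr G$ be a strongly connected directed graph on $\{1,\dots,N\}$ with mixing matrix $\mathbf W=[w_{ij}]$ ($w_{ij}>0$ on edges, $w_{ij}=0$ otherwise) that is doubly stochastic. Put $\alpha=\|\mathbf I-\mathbf W\|_2$ and $\kappa=1-\|\mathbf W-\tfrac1N\mathbf 1\mathbf 1^\top\|_2$ (for symmetric $\mathbf W$ this is the spectral gap). Let $\mathcal T_1,\dots,\mathcal T_N:\mathbb R^n\to\mathbb R^n$ be conservative vector fields that are $L$-Lipschitz with $L>0$ (possibly $L\ge1$), let $\mathcal T=\frac1N\sum_i\mathcal T_i$ have a fixed point, and suppose $\frac1N\sum_i\|\mathcal T_i(x)-\mathcal T(x)\|^2\le\zeta^2$ for all $x$ (with $\zeta\ge0$). Let the oracles $\widetilde{\mathcal T}_i(x,\xi_i)$ satisfy, for all $x$, $$\|\mathbb E\,\widetilde{\mathcal T}_i(x,\xi_i)-\mathcal T_i(x)\|^2\le\beta^2+P\|\mathcal T_i(x)-x\|^2,\quad \mathbb E\|\widetilde{\mathcal T}_i(x,\xi_i)-\mathcal T_i(x)\|^2\le\sigma^2+M\|\mathcal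 T_i(x)-x\|^2,\quad \mathbb E\|\widetilde{\mathcal T}_i(x,\xi_i)-x\|^2\le\mathcal D^2,$$ with $0\le P<1$, $M,\beta,\sigma\ge0$, $\mathcal D>0$. Let the (random) compressor $\mathcal C$ satisfy $\mathbb E\|\mathcal C(x)/r-x\|^2\le(1-\varphi)\|x\|^2+\delta^2$ for all $x$, with $r>0$, $\varphi\in(0,1]$, $\delta\ge0$. Let $\mathcal I$ be a set of communication times with first element $1$ and consecutive gaps at most $\mathcal H$. **Algorithm.** Start from $x_i^0=\hat x_i^0=0$. For $t\ge0$ let $z_i^{t+1}=(1-\eta_t)x_i^t+\eta_t\widetilde{\mathcal T}_i(x_i^t,\xi_i^t)$. If $t+1\in\mathcal I$, let $x_i^{t+1}=z_i^{t+1}+\gamma\sum_jw_{ij}(\hat x_j^t-\hat x_i^t)$ and $\hat x_i^{t+1}=\hat x_i^t+\psi s_t\,\mathcal C((x_i^{t+1}-\hat x_i^t)/s_t)$; otherwise $x_i^{t+1}=z_i^{t+1}$, $\hat x_i^{t+1}=\hat x_i^t$. Each sample $\xi_i^t$ is independent of all randomness used before iteration $t$; the compressor randomness of iteration $t$ is independent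 of that past and of the samples of iteration $t$. **Parameters.** Let $\psi\in(\frac3{4r},\frac1r]$ and $$0<\gamma<\min\Big\{\varphi\Big(8(1+\tfrac4\kappa)\alpha^2+16(1-\tfrac\varphi4)\alpha\Big)^{-1},\ \tfrac{3\kappa}2\Big(\tfrac{9\kappa^2}{16}+2(1-\psi r\varphi)(1+\tfrac4\varphi)\alpha^2\Big)^{-1}\Big\}$$ (the first bound is void if $\alpha=0$), and put $$\zeta_1=\min\Big\{\tfrac\varphi4-2(1+\tfrac4\kappa)\gamma\alpha^2-4(1-\tfrac\varphi4)\gamma\alpha,\ \tfrac{3\kappa\gamma}2-\tfrac{9\kappa^2\gamma^2}{16}-2(1-\psi r\varphi)(1+\tfrac4\varphi)\gamma^2\alpha^2\Big\},$$ $$\begin{aligned}\zeta_2={}&\Big(1+\tfrac4{\kappa\gamma}\Big)\Big[2\gamma^2\alpha^2+3(1+\tfrac{\kappa\gamma}4)\big((1-\kappa\gamma+\gamma)^2+\gamma^2+(1-\kappa\gamma)^2\big)\Big]N\mathcal D^2\\&+(1-\psi r\varphi)(1+\tfrac4\varphi)\Big[(1+\tfrac\varphi4)(1+\gamma\alpha)^2+2\gamma^2\alpha^2\Big]N\mathcal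 D^2,\end{aligned}$$ $$C_1=\frac{16\zeta_2\mathcal H^2+16N\psi r\delta^2}{\zeta_1^2}+8N\mathcal D^2\mathcal H^2 .$$ Let $\eta_t=s_t=b/\sqrt{t+a}$ with $a>\frac{4\mathcal H}{3\zeta_1}$ and $0<b\le\frac{(1-P)\sqrt a}{6(1+L)(1+4M)}$. **Conclusion.** $C_1>0$, the expectations below are finite, and, with $\bar x^t=\frac1N\sum_ix_i^t$, for every $T\ge1$ $$\sum_{t=1}^T\sum_{i=1}^N\mathbb E\|x_i^t-\bar x^t\|^2\le C_1b^2\ln\Big(1+\frac Ta\Big).$$ If moreover the surrogate function $\mathcal G(x)=\int_0^1\langle ux-\mathcal T(ux),x\rangle\,du$ (so that $\nabla\mathcal G(x)=x-\mathcal T(x)$) is bounded below, say $\mathcal G\ge-\Delta$, then for every $T\ge2$ $$\frac1T\sum_{t=1}^T\frac1N\sum_{i=1}^N\mathbb E\|x_i^t-\mathcal T(x_i^t)\|^2\le K_1\frac{C_1\ln T}{\sqrt T}+K_2\,\frac{\beta^2+2P\zeta^2}{P+1},$$ where $K_2$ depends only on $L,P,M,a,b$, and $K_1$ only on $L,P,M,a,b,\sigma,\zeta,\mathcal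 D,\Delta$. -/

import Mathlib

open MeasureTheory ProbabilityTheory
open scoped InnerProductSpace

noncomputable section

namespace DistKM

/-- The space of real vectors of dimension `n`, with the Euclidean norm. -/
abbrev Vec (n : ℕ) : Type := EuclideanSpace ℝ (Fin n)

/-! ### Network -/

/-- There is a directed path between any two agents. -/
def StronglyConnected {N : ℕ} (G : Digraph (Fin N)) : Prop :=
  ∀ i j, Relation.ReflTransGen G.Adj i j

/-- `W` is a doubly stochastic mixing matrix whose positive entries are exactly the edges. -/
structure IsMixingMatrix {N : ℕ} (G : Digraph (Fin N)) (W : Matrix (Fin N) (Fin N) ℝ) : Prop where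
  pos_of_adj : ∀ i j, G.Adj i j → 0 < W i j
  zero_of_not_adj : ∀ i j, ¬ G.Adj i j → W i j = 0
  row_sum : ∀ i, ∑ j, W i j = 1
  col_sum : ∀ j, ∑ i, W i j = 1

/-- Spectral norm (operator norm for the Euclidean norm) of a matrix. -/
def l2Norm {N : ℕ} (A : Matrix (Fin N) (Fin N) ℝ) : ℝ :=
  ‖Matrix.toEuclideanCLM (n := Fin N) (𝕜 := ℝ) A‖

/-- `α = ‖I - W‖₂`. -/
def netAlpha {N : ℕ} (W : Matrix (Fin N) (Fin N) ℝ) : ℝ := l2Norm (1 - W)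

/-- `κ = 1 - ‖W - (1/N) 1 1ᵀ‖₂`; for symmetric `W` this is the spectral gap
`1 - max (|λ₂|, |λ_N|)`. -/
def netKappa {N : ℕ} (W : Matrix (Fin N) (Fin N) ℝ) : ℝ :=
  1 - l2Norm (W - Matrix.of fun _ _ => (1 / N : ℝ))

/-! ### Operators -/

/-- The average of a finite family of vectors. -/
def avg {N n : ℕ} (v : Fin N → Vec n) : Vec n := (1 / N : ℝ) • ∑ i, v i

/-- The global operator, the average of the local operators. -/
def globalOp {N n : ℕ} (F : Fin N → Vec n → Vec n) (x : Vec n) : Vec n := avg fun i => F i x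

/-- `F` is a conservative vector field: it is the gradient of a scalar function. -/
def IsConservative {n : ℕ} (F : Vec n → Vec n) : Prop :=
  ∃ Φ : Vec n → ℝ, ∀ x, HasGradientAt Φ (F x) x

/-- The surrogate function of `F`: the integral of `u - F u` along the segment from `y` to `x`. -/
def surrogate {n : ℕ} (F : Vec n → Vec n) (y x : Vec n) : ℝ :=
  ∫ u in (0 : ℝ)..1, ⟪(y + u • (x - y)) - F (y + u • (x - y)), x - y⟫_ℝ

/-- Bounded heterogeneity of the local operators. -/
def BoundedHeterogeneity {N n : ℕ} (F : Fin N → Vec n → Vec n) (ζ : ℝ) : Prop :=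
  ∀ x, (1 / N : ℝ) * ∑ i, ‖F i x - globalOp F x‖ ^ 2 ≤ ζ ^ 2

/-- `Ft` (evaluated at a sample of law `μ`) is a biased stochastic oracle for `F`, with the growth
conditions on bias and on variance, and with bounded second moment of `Ft x - x`. -/
structure IsBiasedOracle {n : ℕ} {Ξ : Type*} [MeasurableSpace Ξ] (μ : Measure Ξ)
    (F : Vec n → Vec n) (Ft : Vec n → Ξ → Vec n) (β P σ M D : ℝ) : Prop where
  measurable : Measurable (Function.uncurry Ft)
  memLp : ∀ x, MemLp (Ft x) 2 μ
  bias : ∀ x, ‖(∫ w, Ft x w ∂μ) - F x‖ ^ 2 ≤ β ^ 2 + P * ‖F x - x‖ ^ 2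
  variance : ∀ x, ∫ w, ‖Ft x w - F x‖ ^ 2 ∂μ ≤ σ ^ 2 + M * ‖F x - x‖ ^ 2
  second_moment : ∀ x, ∫ w, ‖Ft x w - x‖ ^ 2 ∂μ ≤ D ^ 2

/-- `C` (evaluated at internal randomness of law `ν`) is a compressor with relative error
parameter `φ`, scaling `r` and absolute error `δ`. -/
structure IsCompressor {n : ℕ} {Θ : Type*} [MeasurableSpace Θ] (ν : Measure Θ)
    (C : Vec n → Θ → Vec n) (r φ δ : ℝ) : Prop where
  measurable : Measurable (Function.uncurry C)
  memLp : ∀ x, MemLp (C x) 2 ν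
  error : ∀ x, ∫ w, ‖r⁻¹ • C x w - x‖ ^ 2 ∂ν ≤ (1 - φ) * ‖x‖ ^ 2 + δ ^ 2

/-! ### Communication times and randomness -/

/-- `I` is a set of communication times: its first element is `1`, and consecutive elements differ
by at most `H` (every time `t ≥ 1` is less than `H` steps after some communication time). -/
structure IsSchedule (I : Set ℕ) (H : ℕ) : Prop where
  one_mem : 1 ∈ I
  one_le : ∀ t ∈ I, 1 ≤ t
  gap : ∀ t, 1 ≤ t → ∃ u ∈ I, u ≤ t ∧ t < u + H

section noise

variable {N : ℕ} {Ω Θ : Type*} {Ξ : Fin N → Type*} [MeasurableSpace Θ]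
  [∀ i, MeasurableSpace (Ξ i)]

/-- The σ-algebra generated by all the randomness used in the iterations before `t`. -/
abbrev history (ξ : ℕ → (i : Fin N) → Ω → Ξ i) (θ : ℕ → Fin N → Ω → Θ) (t : ℕ) :
    MeasurableSpace Ω :=
  ⨆ u : Fin t, ⨆ i : Fin N,
    MeasurableSpace.comap (ξ u i) inferInstance ⊔ MeasurableSpace.comap (θ u i) inferInstance

/-- The history, together with the samples drawn in iteration `t`. -/
abbrev historyWithSamples (ξ : ℕ → (i : Fin N) → Ω → Ξ i) (θ : ℕ → Fin N → Ω → Θ) (t : ℕ) :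
    MeasurableSpace Ω :=
  history ξ θ t ⊔ ⨆ i : Fin N, MeasurableSpace.comap (ξ t i) inferInstance

/-- `ξ t i` is the sample of agent `i` in iteration `t`; it has law `μ i` and is independent of the
past. `θ t i` is the internal randomness of the compressor of agent `i` in iteration `t`; it has law
`ν` and is independent of the past and of the samples of iteration `t`. -/
structure IsFreshNoise [MeasurableSpace Ω] (Pr : Measure Ω) (μ : (i : Fin N) → Measure (Ξ i))
    (ν : Measure Θ) (ξ : ℕ → (i : Fin N) → Ω → Ξ i) (θ : ℕ → Fin N → Ω → Θ) : Prop where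
  measurable_sample : ∀ t i, Measurable (ξ t i)
  law_sample : ∀ t i, Pr.map (ξ t i) = μ i
  indep_sample : ∀ t i,
    Indep (MeasurableSpace.comap (ξ t i) inferInstance) (history ξ θ t) Pr
  measurable_compress : ∀ t i, Measurable (θ t i)
  law_compress : ∀ t i, Pr.map (θ t i) = ν
  indep_compress : ∀ t i,
    Indep (MeasurableSpace.comap (θ t i) inferInstance) (historyWithSamples ξ θ t) Pr

end noise

/-! ### The algorithm -/

/-- The local variables `x_i` and the estimates `x̂_i` of all agents (all the agents that store a
copy of `x̂_i` store the same one, since they receive the same messages). -/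
structure State (N n : ℕ) where
  x : Fin N → Vec n
  xhat : Fin N → Vec n

section algorithm

variable {N n : ℕ} {Ω Θ : Type*} {Ξ : Fin N → Type*}

/-- The local relaxed (Krasnosel'skii-Mann) step, with oracle values `g i`. -/
def localStep (η : ℝ) (x g : Fin N → Vec n) (i : Fin N) : Vec n := (1 - η) • x i + η • g i

/-- The consensus step at a communication time. -/
def mixStep (W : Matrix (Fin N) (Fin N) ℝ) (γ : ℝ) (z xhat : Fin N → Vec n) (i : Fin N) : Vec n :=
  z i + γ • ∑ j, W i j • (xhat j - xhat i)

open Classical in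
/-- The state at time `t` of the compressed, period-skipping distributed iteration, with mixing
matrix `W`, step sizes `η`, `γ`, `ψ`, scaling `s`, communication times `I`, oracles `Ft`,
compressor `C`, samples `ξ` and compressor randomness `θ`. -/
def run (W : Matrix (Fin N) (Fin N) ℝ) (γ ψ : ℝ) (η s : ℕ → ℝ) (I : Set ℕ)
    (Ft : (i : Fin N) → Vec n → Ξ i → Vec n) (C : Vec n → Θ → Vec n)
    (ξ : ℕ → (i : Fin N) → Ω → Ξ i) (θ : ℕ → Fin N → Ω → Θ) : ℕ → Ω → State N n
  | 0, _ => ⟨fun _ => 0, fun _ => 0⟩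
  | t + 1, ω =>
    let S := run W γ ψ η s I Ft C ξ θ t ω
    let z := localStep (η t) S.x fun i => Ft i (S.x i) (ξ t i ω)
    if t + 1 ∈ I then
      let x' := mixStep W γ z S.xhat
      ⟨x', fun i => S.xhat i + (ψ * s t) • C ((s t)⁻¹ • (x' i - S.xhat i)) (θ t i ω)⟩
    else ⟨z, S.xhat⟩

end algorithm

/-- The decreasing step size `b / √(t + a)`. -/
def stepSize (a b : ℝ) (t : ℕ) : ℝ := b / √(t + a)

/-! ### Constants -/

/-- `ζ₁(γ)`. -/
def zetaOne (κ α φ ψ r γ : ℝ) : ℝ :=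
  min (φ / 4 - 2 * (1 + 4 / κ) * γ * α ^ 2 - (1 - φ / 4) * (4 * γ * α))
    (3 * κ * γ / 2 - 9 * κ ^ 2 * γ ^ 2 / 16
      - 2 * (1 - ψ * r * φ) * (1 + 4 / φ) * γ ^ 2 * α ^ 2)

/-- `ζ₂(γ)`. -/
def zetaTwo (N : ℕ) (κ α φ ψ r γ D : ℝ) : ℝ :=
  (1 + 4 / (κ * γ)) * (2 * γ ^ 2 * α ^ 2 + 3 * (1 + κ * γ / 4)
      * ((1 - κ * γ + γ) ^ 2 + γ ^ 2 + (1 - κ * γ) ^ 2)) * (N * D ^ 2)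
    + (1 - ψ * r * φ) * (1 + 4 / φ)
      * ((1 + φ / 4) * (1 + γ * α) ^ 2 + 2 * γ ^ 2 * α ^ 2) * (N * D ^ 2)

/-- The consensus constant `C₁`. -/
def consensusConst (N H : ℕ) (κ α φ ψ r γ δ D : ℝ) : ℝ :=
  (16 * zetaTwo N κ α φ ψ r γ D * H ^ 2 + 16 * N * ψ * r * δ ^ 2) / zetaOne κ α φ ψ r γ ^ 2
    + 8 * N * D ^ 2 * H ^ 2

/-- The condition on the consensus step size `γ`: it is positive and smaller than both
`φ (8 (1 + 4/κ) α² + 16 (1 - φ/4) α)⁻¹` and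
`(3κ/2) (9κ²/16 + 2 (1 - ψ r φ) (1 + 4/φ) α²)⁻¹`. The inequalities are multiplied out, so that the
first bound is no restriction when `α = 0` (a single agent). -/
def GammaAdmissible (κ α φ ψ r γ : ℝ) : Prop :=
  0 < γ ∧
  γ * (8 * (1 + 4 / κ) * α ^ 2 + 16 * (1 - φ / 4) * α) < φ ∧
  γ * (9 * κ ^ 2 / 16 + 2 * (1 - ψ * r * φ) * (1 + 4 / φ) * α ^ 2) < 3 * κ / 2

end DistKM

end

open DistKM

noncomputable section

namespace DistKM

/-! ### Elementary inequalities -/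

/-! Two estimates carry the theorem: the agents stay within order `η_t` of their average in mean
square, and the average performs an inexact gradient descent on a potential of `x - 𝒯 x`.

Consensus. Let `y` denote the estimates `x̂`. They are frozen between communications, so a whole
period starting at `τ` acts as one perturbed step `x' = x + v - γ (I - W) y`, where `v` is the sum
of at most `H` weighted increments and has second moment of order `η_τ²`. Writing `y = x - (x - y)`,
the disagreement contracts because `I - W` is `κ`-strongly monotone on zero-sum families and has
norm `α`; it is perturbed by the estimation error `x - y`. The estimation error contracts through
the compressor by `1 - ψrφ` and is perturbed by the disagreement. The conditions on `γ` make the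
cross terms small enough that the sum of the two errors contracts by `1 - ζ₁`
(`IsMixingMatrix.lyapunov_round`). Since `a > 4H/(3ζ₁)`, the squared step sizes decay more slowly
than this contraction, so the sum is `O(η_τ²)` at every communication time
(`IsMixingMatrix.exists_last_round`) and the disagreement is at most `C₁ η_t²` at all times
(`IsMixingMatrix.disagreement_le`).

Descent. Double stochasticity removes the mixing term from the average. Fresh samples allow each
increment, tested against a function of the past, to be replaced by its mean, which is `𝒯_i x_i -
x_i` plus the bias (`integral_inner_of_indep`). Since `P < 1`, this mean remains a descent direction
with margin `(1 - P)/8`, up to bias, heterogeneity and disagreement (`inner_avg_increment_le`).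
Telescoping the expected potential, which is bounded below along the run through the surrogate, and
dividing by `T η_T` gives the rate (`average_le_of_descent`). The bound `8D² ≤ C₁` absorbs all
remaining terms into `K₁ C₁` without letting `K₁` depend on the network. -/

theorem norm_add_sq_le_young {E : Type*} [SeminormedAddCommGroup E] (u v : E) {ε : ℝ}
    (hε : 0 < ε) : ‖u + v‖ ^ 2 ≤ (1 + ε) * ‖u‖ ^ 2 + (1 + 1 / ε) * ‖v‖ ^ 2 := by
  have h1 : ‖u + v‖ ^ 2 ≤ (‖u‖ + ‖v‖) ^ 2 := by gcongr; exact norm_add_le u v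
  have h2 : 0 ≤ (ε * ‖u‖ - ‖v‖) ^ 2 / ε := by positivity
  have h3 : (ε * ‖u‖ - ‖v‖) ^ 2 / ε = ε * ‖u‖ ^ 2 - 2 * ‖u‖ * ‖v‖ + 1 / ε * ‖v‖ ^ 2 := by
    field_simp
    ring
  nlinarith

theorem norm_add_sq_le_two {E : Type*} [SeminormedAddCommGroup E] (u v : E) :
    ‖u + v‖ ^ 2 ≤ 2 * ‖u‖ ^ 2 + 2 * ‖v‖ ^ 2 := by
  have := norm_add_sq_le_young u v one_pos
  norm_num at this
  linarith

theorem norm_sum_sq_le_card_mul {ι E : Type*} [SeminormedAddCommGroup E] (s : Finset ι)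
    (v : ι → E) : ‖∑ i ∈ s, v i‖ ^ 2 ≤ s.card * ∑ i ∈ s, ‖v i‖ ^ 2 :=
  (pow_le_pow_left₀ (norm_nonneg _) (norm_sum_le s v) 2).trans sq_sum_le_card_mul_sum_sq

theorem sum_inv_add_le_log {a : ℝ} (ha : 0 < a) (T : ℕ) :
    ∑ t ∈ Finset.Icc 1 T, 1 / ((t : ℝ) + a) ≤ Real.log (1 + T / a) := by
  induction T with
  | zero => simp
  | succ T ih =>
    rw [Finset.sum_Icc_succ_top (by omega)]
    have hT : (0 : ℝ) < T + a := by positivity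
    have hT' : (0 : ℝ) < T + 1 + a := by positivity
    -- `log x ≤ x - 1` at this ratio says that `1 / (T + 1 + a)` is at most the increment of `log (t
    -- + a)`, so the sum telescopes.
    have h1 : Real.log ((T + a) / (T + 1 + a)) ≤ (T + a) / (T + 1 + a) - 1 :=
      Real.log_le_sub_one_of_pos (by positivity)
    have h2 : (1 : ℝ) + T / a = (T + a) / a := by field_simp; ring
    have h3 : (1 : ℝ) + (T + 1) / a = (T + 1 + a) / a := by field_simp; ring
    rw [h2, Real.log_div hT.ne' ha.ne'] at ih
    rw [Real.log_div hT.ne' hT'.ne'] at h1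
    push_cast
    rw [h3, Real.log_div hT'.ne' ha.ne']
    have h4 : ((T : ℝ) + a) / (T + 1 + a) - 1 = -(1 / (T + 1 + a)) := by field_simp; ring
    linarith

theorem sum_inv_sqrt_add_le {a : ℝ} (ha : 0 < a) (T : ℕ) :
    ∑ t ∈ Finset.range (T + 1), 1 / √((t : ℝ) + a) ≤ 1 / √a + 2 * √(T + a) := by
  induction T with
  | zero => simp
  | succ T ih =>
    rw [Finset.sum_range_succ]
    push_cast
    have hu : 0 ≤ √((T : ℝ) + a) := Real.sqrt_nonneg _
    have hv : 0 < √((T : ℝ) + 1 + a) := Real.sqrt_pos.2 (by positivity)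
    have hu2 : √((T : ℝ) + a) ^ 2 = T + a := Real.sq_sqrt (by positivity)
    have hv2 : √((T : ℝ) + 1 + a) ^ 2 = T + 1 + a := Real.sq_sqrt (by positivity)
    have : 1 / √((T : ℝ) + 1 + a) ≤ 2 * √((T : ℝ) + 1 + a) - 2 * √((T : ℝ) + a) := by
      rw [div_le_iff₀ hv]
      nlinarith [sq_nonneg (√((T : ℝ) + 1 + a) - √((T : ℝ) + a))]
    linarith

/-! ### Step sizes -/

theorem stepSize_pos {a b : ℝ} (ha : 0 < a) (hb : 0 < b) (t : ℕ) : 0 < stepSize a b t :=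
  div_pos hb (Real.sqrt_pos.2 (by positivity))

theorem stepSize_sq {a : ℝ} (b : ℝ) (ha : 0 < a) (t : ℕ) :
    stepSize a b t ^ 2 = b ^ 2 / (t + a) := by
  rw [stepSize, div_pow, Real.sq_sqrt (by positivity)]

theorem stepSize_antitone {a b : ℝ} (ha : 0 < a) (hb : 0 < b) : Antitone (stepSize a b) := by
  intro s t h
  unfold stepSize
  have : (s : ℝ) ≤ t := by exact_mod_cast h
  have : 0 < √((s : ℝ) + a) := Real.sqrt_pos.2 (by positivity)
  gcongr

/-! ### Averages -/

section avg

variable {N n : ℕ}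

theorem avg_add (u v : Fin N → Vec n) : (avg fun i => u i + v i) = avg u + avg v := by
  simp [avg, Finset.sum_add_distrib]

theorem avg_sub (u v : Fin N → Vec n) : (avg fun i => u i - v i) = avg u - avg v := by
  simp [avg, Finset.sum_sub_distrib, smul_sub]

theorem avg_smul (c : ℝ) (v : Fin N → Vec n) : (avg fun i => c • v i) = c • avg v := by
  simp only [avg, ← Finset.smul_sum]
  rw [smul_comm]

theorem avg_const (hN : 1 ≤ N) (c : Vec n) : (avg fun _ : Fin N => c) = c := by
  have : (N : ℝ) ≠ 0 := by positivity
  simp [avg, ← Nat.cast_smul_eq_nsmul ℝ, smul_smul, this]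

theorem sum_sub_avg (hN : 1 ≤ N) (v : Fin N → Vec n) : ∑ i, (v i - avg v) = 0 := by
  have : (N : ℝ) ≠ 0 := by positivity
  simp [avg, ← Nat.cast_smul_eq_nsmul ℝ, smul_smul, this]

theorem norm_avg_sq_le (hN : 1 ≤ N) (v : Fin N → Vec n) :
    ‖avg v‖ ^ 2 ≤ (1 / N : ℝ) * ∑ i, ‖v i‖ ^ 2 := by
  have hN' : (0 : ℝ) < N := by positivity
  have h := norm_sum_sq_le_card_mul Finset.univ v
  rw [Finset.card_univ, Fintype.card_fin] at h
  rw [avg, norm_smul, mul_pow, Real.norm_of_nonneg (by positivity)]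
  calc (1 / N : ℝ) ^ 2 * ‖∑ i, v i‖ ^ 2 ≤ (1 / N : ℝ) ^ 2 * (N * ∑ i, ‖v i‖ ^ 2) := by gcongr
    _ = (1 / N : ℝ) * ∑ i, ‖v i‖ ^ 2 := by field_simp

theorem inner_avg (c : Vec n) (v : Fin N → Vec n) :
    ⟪c, avg v⟫_ℝ = (1 / N : ℝ) * ∑ i, ⟪c, v i⟫_ℝ := by
  simp [avg, inner_smul_right, inner_sum]

/-- The decomposition of the second moment into the squared mean and the variance. -/
theorem sum_norm_sq_eq_add_sum_sub_avg (hN : 1 ≤ N) (v : Fin N → Vec n) :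
    (1 / N : ℝ) * ∑ i, ‖v i‖ ^ 2 = ‖avg v‖ ^ 2 + (1 / N : ℝ) * ∑ i, ‖v i - avg v‖ ^ 2 := by
  have hN' : (N : ℝ) ≠ 0 := by positivity
  have h0 : ∑ i, ⟪avg v, v i - avg v⟫_ℝ = 0 := by
    rw [← inner_sum, sum_sub_avg hN, inner_zero_right]
  have h1 : ∀ i, ‖v i‖ ^ 2 = ‖avg v‖ ^ 2 + 2 * ⟪avg v, v i - avg v⟫_ℝ + ‖v i - avg v‖ ^ 2 := by
    intro i
    rw [← norm_add_sq_real, add_sub_cancel]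
  rw [Finset.sum_congr rfl fun i _ => h1 i, Finset.sum_add_distrib, Finset.sum_add_distrib,
    ← Finset.mul_sum, h0]
  simp
  field_simp

theorem sum_norm_sub_avg_sq_le (hN : 1 ≤ N) (v : Fin N → Vec n) :
    ∑ i, ‖v i - avg v‖ ^ 2 ≤ ∑ i, ‖v i‖ ^ 2 := by
  have hN' : (0 : ℝ) < 1 / N := by positivity
  have h := sum_norm_sq_eq_add_sum_sub_avg hN v
  have : 0 ≤ ‖avg v‖ ^ 2 := by positivity
  exact le_of_mul_le_mul_left (by linarith) hN'

end avg

/-! ### Matrices acting on families of vectors -/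

section matAct

variable {N n : ℕ}

/-- The action of a matrix on a family of vectors. -/
def matAct (A : Matrix (Fin N) (Fin N) ℝ) (v : Fin N → Vec n) (i : Fin N) : Vec n :=
  ∑ j, A i j • v j

theorem matAct_sub (A : Matrix (Fin N) (Fin N) ℝ) (u v : Fin N → Vec n) (i : Fin N) :
    matAct A (fun j => u j - v j) i = matAct A u i - matAct A v i := by
  simp [matAct, smul_sub, Finset.sum_sub_distrib]

theorem matAct_sub_left (A B : Matrix (Fin N) (Fin N) ℝ) (v : Fin N → Vec n) (i : Fin N) :
    matAct (A - B) v i = matAct A v i - matAct B v i := by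
  simp [matAct, sub_smul, Finset.sum_sub_distrib]

theorem matAct_one (v : Fin N → Vec n) (i : Fin N) : matAct 1 v i = v i := by
  simp [matAct, Matrix.one_apply, ite_smul]

theorem l2Norm_nonneg (A : Matrix (Fin N) (Fin N) ℝ) : 0 ≤ l2Norm A := norm_nonneg _

/-- The `k`-th coordinates of a family of vectors. -/
def coordVec (v : Fin N → Vec n) (k : Fin n) : EuclideanSpace ℝ (Fin N) :=
  WithLp.toLp 2 fun i => v i k

theorem coordVec_matAct (A : Matrix (Fin N) (Fin N) ℝ) (v : Fin N → Vec n) (k : Fin n) :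
    coordVec (matAct A v) k = Matrix.toEuclideanCLM (n := Fin N) (𝕜 := ℝ) A (coordVec v k) := by
  ext i
  simp [coordVec, matAct, Matrix.mulVec, dotProduct]

theorem sum_norm_sq_eq_coordVec (v : Fin N → Vec n) :
    ∑ i, ‖v i‖ ^ 2 = ∑ k, ‖coordVec v k‖ ^ 2 := by
  simp_rw [EuclideanSpace.norm_sq_eq]
  rw [Finset.sum_comm]
  rfl

theorem sum_inner_eq_coordVec (u v : Fin N → Vec n) :
    ∑ i, ⟪u i, v i⟫_ℝ = ∑ k, ⟪coordVec u k, coordVec v k⟫_ℝ := by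
  simp_rw [PiLp.inner_apply]
  rw [Finset.sum_comm]
  rfl

/-- The matrix acts separately on each of the `n` coordinates, so the scalar operator norm bound is
applied coordinate by coordinate and summed. -/
theorem sum_norm_matAct_sq_le (A : Matrix (Fin N) (Fin N) ℝ) (v : Fin N → Vec n) :
    ∑ i, ‖matAct A v i‖ ^ 2 ≤ l2Norm A ^ 2 * ∑ i, ‖v i‖ ^ 2 := by
  rw [sum_norm_sq_eq_coordVec (matAct A v), sum_norm_sq_eq_coordVec v, Finset.mul_sum]
  gcongr with k
  rw [coordVec_matAct, ← mul_pow]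
  gcongr
  exact ContinuousLinearMap.le_opNorm _ _

theorem sum_inner_matAct_le (A : Matrix (Fin N) (Fin N) ℝ) (v : Fin N → Vec n) :
    ∑ i, ⟪v i, matAct A v i⟫_ℝ ≤ l2Norm A * ∑ i, ‖v i‖ ^ 2 := by
  rw [sum_norm_sq_eq_coordVec, sum_inner_eq_coordVec, Finset.mul_sum]
  gcongr with k
  rw [coordVec_matAct]
  calc _ ≤ ‖coordVec v k‖ * ‖Matrix.toEuclideanCLM (n := Fin N) (𝕜 := ℝ) A (coordVec v k)‖ :=
        real_inner_le_norm _ _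
    _ ≤ ‖coordVec v k‖ * (l2Norm A * ‖coordVec v k‖) := by
        gcongr
        exact ContinuousLinearMap.le_opNorm _ _
    _ = _ := by ring

variable {G : Digraph (Fin N)} {W : Matrix (Fin N) (Fin N) ℝ}

theorem IsMixingMatrix.sum_matAct_one_sub (hW : IsMixingMatrix G W) (v : Fin N → Vec n) :
    ∑ i, matAct (1 - W) v i = 0 := by
  simp_rw [matAct_sub_left, matAct_one]
  rw [Finset.sum_sub_distrib]
  simp_rw [matAct]
  rw [Finset.sum_comm]
  simp_rw [← Finset.sum_smul, hW.col_sum]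
  simp

theorem IsMixingMatrix.matAct_one_sub_const (hW : IsMixingMatrix G W) (c : Vec n) (i : Fin N) :
    matAct (1 - W) (fun _ => c) i = 0 := by
  rw [matAct_sub_left, matAct_one, matAct, ← Finset.sum_smul, hW.row_sum, one_smul, sub_self]

theorem IsMixingMatrix.mixStep_eq (hW : IsMixingMatrix G W) (γ : ℝ) (z y : Fin N → Vec n)
    (i : Fin N) : mixStep W γ z y i = z i - γ • matAct (1 - W) y i := by
  rw [mixStep, matAct_sub_left, matAct_one, matAct]
  simp_rw [smul_sub]
  rw [Finset.sum_sub_distrib, ← Finset.sum_smul, hW.row_sum, one_smul]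
  module

/-- On families with zero sum, `I - W` is strongly monotone. -/
theorem netKappa_mul_le_sum_inner (W : Matrix (Fin N) (Fin N) ℝ) {v : Fin N → Vec n}
    (hv : ∑ i, v i = 0) :
    netKappa W * ∑ i, ‖v i‖ ^ 2 ≤ ∑ i, ⟪v i, matAct (1 - W) v i⟫_ℝ := by
  have h := sum_inner_matAct_le (W - Matrix.of fun _ _ => (1 / N : ℝ)) v
  -- The averaging matrix annihilates zero-sum families, so the norm `1 - κ` of the deflated matrix
  -- controls `W` there.
  have h0 : ∀ i, matAct (W - Matrix.of fun _ _ => (1 / N : ℝ)) v i = matAct W v i := by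
    intro i
    rw [matAct_sub_left]
    simp [matAct, ← Finset.smul_sum, hv]
  simp_rw [h0] at h
  simp_rw [matAct_sub_left, matAct_one, inner_sub_right, real_inner_self_eq_norm_sq]
  rw [Finset.sum_sub_distrib, netKappa]
  linarith

theorem sum_norm_sub_smul_matAct_sq_le {γ : ℝ} (hγ : 0 ≤ γ) (W : Matrix (Fin N) (Fin N) ℝ)
    {v : Fin N → Vec n} (hv : ∑ i, v i = 0) :
    ∑ i, ‖v i - γ • matAct (1 - W) v i‖ ^ 2
      ≤ (1 - 2 * γ * netKappa W + γ ^ 2 * netAlpha W ^ 2) * ∑ i, ‖v i‖ ^ 2 := by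
  have h1 := netKappa_mul_le_sum_inner W hv
  have h2 := sum_norm_matAct_sq_le (1 - W) v
  simp_rw [norm_sub_sq_real, inner_smul_right, norm_smul, mul_pow, Real.norm_eq_abs, sq_abs]
  rw [Finset.sum_add_distrib, Finset.sum_sub_distrib, ← Finset.mul_sum, ← Finset.mul_sum,
    ← Finset.mul_sum]
  have h3 := mul_le_mul_of_nonneg_left h1 hγ
  have h4 := mul_le_mul_of_nonneg_left h2 (sq_nonneg γ)
  rw [netAlpha]
  nlinarith

theorem netKappa_le_one (W : Matrix (Fin N) (Fin N) ℝ) : netKappa W ≤ 1 := by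
  have := l2Norm_nonneg (W - Matrix.of fun _ _ => (1 / N : ℝ))
  rw [netKappa]
  linarith

/-- On a nonzero zero-sum family the quadratic form of `I - W` lies between `κ` and `α` times the
squared norm. Such a family exists only for at least two agents, which is why a single agent is
treated separately later. -/
theorem netKappa_le_netAlpha (hN : 2 ≤ N) (W : Matrix (Fin N) (Fin N) ℝ) :
    netKappa W ≤ netAlpha W := by
  obtain ⟨m, rfl⟩ : ∃ m, N = m + 2 := ⟨N - 2, by omega⟩
  let c : Vec 1 := EuclideanSpace.single 0 1
  let v : Fin (m + 2) → Vec 1 := fun i => (if i = 0 then c else 0) - (if i = 1 then c else 0)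
  have hv : ∑ i, v i = 0 := by simp [v, Finset.sum_sub_distrib]
  have h1 := netKappa_mul_le_sum_inner W hv
  have h2 := sum_inner_matAct_le (1 - W) v
  have h3 : 0 < ∑ i, ‖v i‖ ^ 2 := by
    refine Finset.sum_pos' (fun i _ => by positivity) ⟨0, Finset.mem_univ _, ?_⟩
    simp [v, c]
  exact le_of_mul_le_mul_right (h1.trans h2) h3

end matAct

/-! ### One communication round, pathwise -/

section round

variable {N n : ℕ} {G : Digraph (Fin N)} {W : Matrix (Fin N) (Fin N) ℝ}

theorem sum_norm_add_smul_matAct_sq_le {γ : ℝ} (hγ : 0 ≤ γ) (W : Matrix (Fin N) (Fin N) ℝ)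
    (v : Fin N → Vec n) :
    ∑ i, ‖v i + γ • matAct (1 - W) v i‖ ^ 2 ≤ (1 + γ * netAlpha W) ^ 2 * ∑ i, ‖v i‖ ^ 2 := by
  have h1 := sum_inner_matAct_le (1 - W) v
  have h2 := sum_norm_matAct_sq_le (1 - W) v
  simp_rw [norm_add_sq_real, inner_smul_right, norm_smul, mul_pow, Real.norm_eq_abs, sq_abs]
  rw [Finset.sum_add_distrib, Finset.sum_add_distrib, ← Finset.mul_sum, ← Finset.mul_sum,
    ← Finset.mul_sum]
  have h3 := mul_le_mul_of_nonneg_left h1 hγ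
  have h4 := mul_le_mul_of_nonneg_left h2 (sq_nonneg γ)
  rw [netAlpha]
  nlinarith

theorem sum_norm_smul_matAct_add_sq_le (γ : ℝ) (W : Matrix (Fin N) (Fin N) ℝ)
    (u v : Fin N → Vec n) :
    ∑ i, ‖γ • matAct (1 - W) u i + v i‖ ^ 2
      ≤ 2 * γ ^ 2 * netAlpha W ^ 2 * ∑ i, ‖u i‖ ^ 2 + 2 * ∑ i, ‖v i‖ ^ 2 := by
  have h1 := sum_norm_matAct_sq_le (1 - W) u
  have h2 : ∑ i, ‖γ • matAct (1 - W) u i + v i‖ ^ 2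
      ≤ ∑ i, (2 * (γ ^ 2 * ‖matAct (1 - W) u i‖ ^ 2) + 2 * ‖v i‖ ^ 2) := by
    refine Finset.sum_le_sum fun i _ => (norm_add_sq_le_two _ _).trans_eq ?_
    rw [norm_smul, mul_pow, Real.norm_eq_abs, sq_abs]
  rw [Finset.sum_add_distrib, ← Finset.mul_sum, ← Finset.mul_sum, ← Finset.mul_sum] at h2
  have h3 := mul_le_mul_of_nonneg_left h1 (sq_nonneg γ)
  rw [netAlpha]
  nlinarith

theorem sum_norm_add_sq_le_young {u v : Fin N → Vec n} {ε A B : ℝ} (hε : 0 < ε)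
    (hu : ∑ i, ‖u i‖ ^ 2 ≤ A) (hv : ∑ i, ‖v i‖ ^ 2 ≤ B) :
    ∑ i, ‖u i + v i‖ ^ 2 ≤ (1 + ε) * A + (1 + 1 / ε) * B := by
  have h : ∑ i, ‖u i + v i‖ ^ 2 ≤ ∑ i, ((1 + ε) * ‖u i‖ ^ 2 + (1 + 1 / ε) * ‖v i‖ ^ 2) :=
    Finset.sum_le_sum fun i _ => norm_add_sq_le_young _ _ hε
  rw [Finset.sum_add_distrib, ← Finset.mul_sum, ← Finset.mul_sum] at h
  refine h.trans ?_
  gcongr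

theorem IsMixingMatrix.avg_round (hW : IsMixingMatrix G W) {γ : ℝ} {x y v x' : Fin N → Vec n}
    (hx' : ∀ i, x' i = x i + v i - γ • matAct (1 - W) y i) : avg x' = avg x + avg v := by
  have h : x' = fun i => (x i + v i) - γ • matAct (1 - W) y i := funext hx'
  have h0 : avg (matAct (1 - W) y) = 0 := by rw [avg, hW.sum_matAct_one_sub, smul_zero]
  rw [h, avg_sub, avg_add, avg_smul, h0, smul_zero, sub_zero]

/-- Centring gives `x' - x̄' = (I - γ(I - W))(x - x̄) + [γ(I - W)(x - y) + (v - v̄)]`, because `I -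
W` kills constants and preserves the zero sum. The bracket is split off by Young's inequality with
weight `κγ/4`, small against the gain `2κγ` of the first term. -/
theorem IsMixingMatrix.consensus_round (hW : IsMixingMatrix G W) (hN : 1 ≤ N) {γ : ℝ}
    (hγ : 0 < γ) (hκ : 0 < netKappa W) {x y v x' : Fin N → Vec n}
    (hx' : ∀ i, x' i = x i + v i - γ • matAct (1 - W) y i) :
    ∑ i, ‖x' i - avg x'‖ ^ 2
      ≤ (1 + netKappa W * γ / 4) * ((1 - 2 * γ * netKappa W + γ ^ 2 * netAlpha W ^ 2)
          * ∑ i, ‖x i - avg x‖ ^ 2)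
        + (1 + 4 / (netKappa W * γ)) * (2 * γ ^ 2 * netAlpha W ^ 2 * ∑ i, ‖x i - y i‖ ^ 2
          + 2 * ∑ i, ‖v i‖ ^ 2) := by
  have h1 := sum_norm_sub_smul_matAct_sq_le hγ.le W (sum_sub_avg hN x)
  have h2 := sum_norm_smul_matAct_add_sq_le γ W (fun i => x i - y i) (fun i => v i - avg v)
  have h3 := sum_norm_sub_avg_sq_le hN v
  have h4 := sum_norm_add_sq_le_young (ε := netKappa W * γ / 4) (by positivity) h1
    (h2.trans (add_le_add_right (mul_le_mul_of_nonneg_left h3 zero_le_two) _))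
  rw [one_div_div] at h4
  refine le_of_eq_of_le (Finset.sum_congr rfl fun i _ => ?_) h4
  congr 2
  rw [hW.avg_round hx', hx' i, matAct_sub, matAct_sub, hW.matAct_one_sub_const]
  module

/-- Here `x' - y = (I + γ(I - W))(x - y) + [-γ(I - W)(x - x̄) + v]`. The first factor expands
slightly; the compressor compensates for this afterwards, and the Young weight `φ/4` is chosen to
fit within its gain. -/
theorem IsMixingMatrix.estimate_round (hW : IsMixingMatrix G W) {γ φ : ℝ}
    (hγ : 0 < γ) (hφ : 0 < φ) {x y v x' : Fin N → Vec n}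
    (hx' : ∀ i, x' i = x i + v i - γ • matAct (1 - W) y i) :
    ∑ i, ‖x' i - y i‖ ^ 2
      ≤ (1 + φ / 4) * ((1 + γ * netAlpha W) ^ 2 * ∑ i, ‖x i - y i‖ ^ 2)
        + (1 + 4 / φ) * (2 * γ ^ 2 * netAlpha W ^ 2 * ∑ i, ‖x i - avg x‖ ^ 2
          + 2 * ∑ i, ‖v i‖ ^ 2) := by
  have h1 := sum_norm_add_smul_matAct_sq_le hγ.le W (fun i => x i - y i)
  have h2 := sum_norm_smul_matAct_add_sq_le (-γ) W (fun i => x i - avg x) v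
  have h4 := sum_norm_add_sq_le_young (ε := φ / 4) (by positivity) h1 h2
  rw [one_div_div, neg_sq] at h4
  refine le_of_eq_of_le (Finset.sum_congr rfl fun i _ => ?_) h4
  congr 2
  rw [hx' i, matAct_sub, matAct_sub, hW.matAct_one_sub_const]
  module

end round

/-! ### The constants -/

section constants

variable {κ α φ ψ r γ : ℝ}

theorem scaled_gain_bounds (hr : 0 < r) (hφ0 : 0 < φ) (hψ0 : 3 / (4 * r) < ψ) (hψ1 : ψ ≤ 1 / r) :
    3 / 4 < ψ * r ∧ ψ * r ≤ 1 ∧ 3 * φ / 4 ≤ ψ * r * φ ∧ ψ * r * φ ≤ φ := by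
  have h1 : 3 / 4 < ψ * r := by
    rw [div_lt_iff₀ (by positivity)] at hψ0
    linarith
  have h2 : ψ * r ≤ 1 := (le_div_iff₀ hr).1 hψ1
  refine ⟨h1, h2, ?_, ?_⟩ <;> nlinarith

theorem zetaOne_pos (hγ : GammaAdmissible κ α φ ψ r γ) : 0 < zetaOne κ α φ ψ r γ := by
  obtain ⟨h0, h1, h2⟩ := hγ
  refine lt_min (by nlinarith) ?_
  have := mul_lt_mul_of_pos_right h2 h0
  nlinarith

theorem zetaOne_le (hγ : GammaAdmissible κ α φ ψ r γ) (hκ : 0 < κ) (hα : 0 ≤ α) (hφ : φ ≤ 1) :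
    zetaOne κ α φ ψ r γ ≤ 1 / 4 := by
  refine (min_le_left _ _).trans ?_
  have h0 : 0 < γ := hγ.1
  have h1 : 0 ≤ 2 * (1 + 4 / κ) * γ * α ^ 2 := by positivity
  have h2 : 0 ≤ (1 - φ / 4) * (4 * γ * α) := mul_nonneg (by linarith) (by positivity)
  linarith

/-- The left side of the second bound on `γ` is nonnegative, so an admissible `γ` already forces a
positive gap. -/
theorem kappa_pos_of_admissible (hγ : GammaAdmissible κ α φ ψ r γ) (hφ0 : 0 < φ)
    (hp : ψ * r * φ ≤ 1) : 0 < κ := by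
  obtain ⟨h0, -, h2⟩ := hγ
  have : 0 ≤ 2 * (1 - ψ * r * φ) * (1 + 4 / φ) * α ^ 2 := by
    have : 0 ≤ 1 - ψ * r * φ := by linarith
    positivity
  have : 0 ≤ γ * (9 * κ ^ 2 / 16 + 2 * (1 - ψ * r * φ) * (1 + 4 / φ) * α ^ 2) := by positivity
  linarith

theorem admissible_bounds (hγ : GammaAdmissible κ α φ ψ r γ) (hκ : 0 < κ) (hα : 0 ≤ α)
    (hφ1 : φ ≤ 1) :
    γ * α ≤ 1 / 12 ∧ 32 * (γ * α ^ 2) ≤ φ * κ := by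
  obtain ⟨h0, h1, -⟩ := hγ
  have e1 : 0 ≤ γ * α := by positivity
  have e2 : 0 ≤ γ * α ^ 2 := by positivity
  have e3 : 0 ≤ γ * α ^ 2 * (4 / κ) := by positivity
  constructor
  · nlinarith
  · have h2 : 8 * (γ * α ^ 2 * (4 / κ)) ≤ φ := by nlinarith
    have h3 : γ * α ^ 2 * (4 / κ) = 4 * (γ * α ^ 2) / κ := by ring
    rw [h3, ← mul_div_assoc, div_le_iff₀ hκ] at h2
    linarith

/-- The compressor gain `1 - 3φ/4` absorbs the Young factor `1 + φ/4` and leaves `1 - φ/4`. With `g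
= γα ≤ 1/12`, the quadratic terms in `g` fit into the slack between `(1 + g)²` and `1 + 4g`. -/
theorem estimate_coeff_le (hγ : GammaAdmissible κ α φ ψ r γ) (hκ : 0 < κ) (hα : 0 ≤ α)
    (hφ0 : 0 < φ) (hφ1 : φ ≤ 1) (hp : 3 * φ / 4 ≤ ψ * r * φ) :
    (1 + 4 / (κ * γ)) * (2 * γ ^ 2 * α ^ 2)
        + (1 - ψ * r * φ) * ((1 + φ / 4) * (1 + γ * α) ^ 2)
      ≤ 1 - zetaOne κ α φ ψ r γ := by
  obtain ⟨h1, -⟩ := admissible_bounds hγ hκ hα hφ1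
  have h0 : 0 < γ := hγ.1
  have hz : zetaOne κ α φ ψ r γ
      ≤ φ / 4 - 2 * (1 + 4 / κ) * γ * α ^ 2 - (1 - φ / 4) * (4 * γ * α) := min_le_left _ _
  have e1 : 0 ≤ γ * α := by positivity
  have e : (1 + 4 / (κ * γ)) * (2 * γ ^ 2 * α ^ 2)
      = 2 * (γ * α) ^ 2 + 2 * (4 / κ) * γ * α ^ 2 := by field_simp
  have h2 : (1 - ψ * r * φ) * ((1 + φ / 4) * (1 + γ * α) ^ 2)
      ≤ (1 - φ / 4) * (1 + γ * α) ^ 2 := by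
    rw [← mul_assoc]
    refine mul_le_mul_of_nonneg_right ?_ (sq_nonneg _)
    nlinarith
  have h3 : 0 ≤ γ * α ^ 2 := by positivity
  rw [e]
  set g := γ * α with hg
  have h5 : 2 * g ^ 2 + (1 - φ / 4) * (1 + g) ^ 2 ≤ (1 - φ / 4) * (1 + 4 * g) := by
    have : (3 / 4) * (g * (2 - g)) ≤ (1 - φ / 4) * (g * (2 - g)) :=
      mul_le_mul_of_nonneg_right (by linarith) (mul_nonneg e1 (by linarith))
    nlinarith
  have h6 : (1 - φ / 4) * (4 * γ * α) = (1 - φ / 4) * (4 * g) := by rw [hg]; ring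
  rw [h6] at hz
  nlinarith

/-- Admissibility makes `γ²α²` at most `κγ/32`, so of the gain `2κγ` more than `3κγ/2` survives the
Young factor. -/
theorem consensus_coeff_le (hγ : GammaAdmissible κ α φ ψ r γ) (hκ : 0 < κ) (hα : 0 ≤ α)
    (hφ1 : φ ≤ 1) :
    (1 + κ * γ / 4) * (1 - 2 * γ * κ + γ ^ 2 * α ^ 2)
        + (1 - ψ * r * φ) * ((1 + 4 / φ) * (2 * γ ^ 2 * α ^ 2))
      ≤ 1 - zetaOne κ α φ ψ r γ := by
  obtain ⟨-, h2⟩ := admissible_bounds hγ hκ hα hφ1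
  have h0 : 0 < γ := hγ.1
  have hz : zetaOne κ α φ ψ r γ ≤ 3 * κ * γ / 2 - 9 * κ ^ 2 * γ ^ 2 / 16
      - 2 * (1 - ψ * r * φ) * (1 + 4 / φ) * γ ^ 2 * α ^ 2 := min_le_right _ _
  have hu : 0 < κ * γ := by positivity
  have h3 : γ ^ 2 * α ^ 2 ≤ κ * γ / 32 := by nlinarith
  have h4 : (1 + κ * γ / 4) * (1 - 2 * γ * κ + γ ^ 2 * α ^ 2)
      ≤ (1 + κ * γ / 4) * (1 - 2 * γ * κ + κ * γ / 32) := by gcongr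
  nlinarith

theorem zetaTwo_pos {N : ℕ} {D : ℝ} (hN : 1 ≤ N) (hD : 0 < D) (hκ : 0 < κ)
    (hα : 0 ≤ α) (hγ : 0 < γ) (hφ0 : 0 < φ) (hp : ψ * r * φ ≤ 1) :
    0 < zetaTwo N κ α φ ψ r γ D := by
  have h1 : 0 ≤ 1 - ψ * r * φ := by linarith
  have h2 : 0 < (N : ℝ) := by positivity
  unfold zetaTwo
  positivity

/-- Both noise contributions carry a factor 2. In `ζ₂` the first bracket is at least 3 and the
second at least 1; the spare unit of the first pays for the missing unit of the second, since `κ ≤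
α` gives `κγ ≤ φ` and hence `4/φ ≤ 4/(κγ)`. -/
theorem noise_coeff_le {N : ℕ} {D : ℝ} (hγ : GammaAdmissible κ α φ ψ r γ) (hκ : 0 < κ)
    (hκ1 : κ ≤ 1) (hκα : κ ≤ α) (hφ0 : 0 < φ) (hφ1 : φ ≤ 1) (hp0 : 0 ≤ ψ * r * φ)
    (hp : ψ * r * φ ≤ 1) :
    ((1 + 4 / (κ * γ)) * 2 + (1 - ψ * r * φ) * ((1 + 4 / φ) * 2)) * (N * D ^ 2)
      ≤ zetaTwo N κ α φ ψ r γ D := by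
  obtain ⟨-, h2⟩ := admissible_bounds hγ hκ (hκ.le.trans hκα) hφ1
  have h0 : 0 < γ := hγ.1
  have hα : 0 < α := hκ.trans_le hκα
  have h3 : 32 * (κ * γ) ≤ φ := by
    refine le_of_mul_le_mul_right ?_ hκ
    have : γ * κ ^ 2 ≤ γ * α ^ 2 := by gcongr
    linarith
  have h4 : 4 / φ ≤ 4 / (κ * γ) := by
    gcongr
    linarith [mul_pos hκ h0]
  have h5 : 0 ≤ 1 - ψ * r * φ := by linarith
  unfold zetaTwo
  rw [← add_mul]
  refine mul_le_mul_of_nonneg_right ?_ (by positivity)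
  have h6 : 1 ≤ (1 - κ * γ + γ) ^ 2 := by nlinarith [mul_nonneg h0.le (sub_nonneg.2 hκ1)]
  have h7 : 3 ≤ 2 * γ ^ 2 * α ^ 2 + 3 * (1 + κ * γ / 4)
      * ((1 - κ * γ + γ) ^ 2 + γ ^ 2 + (1 - κ * γ) ^ 2) := by
    have : 1 * 1 ≤ (1 + κ * γ / 4) * ((1 - κ * γ + γ) ^ 2 + γ ^ 2 + (1 - κ * γ) ^ 2) := by
      gcongr
      · linarith [mul_pos hκ h0]
      · linarith [sq_nonneg γ, sq_nonneg (1 - κ * γ)]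
    have : 0 ≤ 2 * γ ^ 2 * α ^ 2 := by positivity
    linarith
  have h8 : 1 ≤ (1 + φ / 4) * (1 + γ * α) ^ 2 + 2 * γ ^ 2 * α ^ 2 := by
    have : 1 * 1 ≤ (1 + φ / 4) * (1 + γ * α) ^ 2 := by
      gcongr
      · linarith
      · nlinarith [mul_pos h0 hα]
    have : 0 ≤ 2 * γ ^ 2 * α ^ 2 := by positivity
    linarith
  have h9 : (1 - ψ * r * φ) * (1 + 4 / φ) ≤ 1 + 4 / (κ * γ) := by
    have : 0 < 4 / φ := by positivity
    nlinarith
  have h10 := mul_le_mul_of_nonneg_left h7 (show 0 ≤ 1 + 4 / (κ * γ) by positivity)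
  have h11 := mul_le_mul_of_nonneg_left h8 (show 0 ≤ (1 - ψ * r * φ) * (1 + 4 / φ) by positivity)
  linarith

/-- A lower bound on `C₁` in terms of `D` alone: terms of the descent estimate that do not scale
with `C₁` can then be multiplied by `C₁ / (8D²)`. -/
theorem le_consensusConst {N H : ℕ} {δ D : ℝ} (hN : 1 ≤ N) (hH : 1 ≤ H)
    (hζ₂ : 0 ≤ zetaTwo N κ α φ ψ r γ D) (hψr : 0 ≤ ψ * r) :
    8 * D ^ 2 ≤ consensusConst N H κ α φ ψ r γ δ D := by
  have h1 : 0 ≤ (16 * zetaTwo N κ α φ ψ r γ D * H ^ 2 + 16 * N * ψ * r * δ ^ 2)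
      / zetaOne κ α φ ψ r γ ^ 2 := by
    have : 16 * (N : ℝ) * ψ * r * δ ^ 2 = 16 * N * (ψ * r) * δ ^ 2 := by ring
    rw [this]
    positivity
  have hN' : (1 : ℝ) ≤ N := by exact_mod_cast hN
  have hH' : (1 : ℝ) ≤ (H : ℝ) ^ 2 := one_le_pow₀ (by exact_mod_cast hH)
  have h2 : 1 * 1 ≤ (N : ℝ) * (H : ℝ) ^ 2 := by gcongr
  have h3 := mul_le_mul_of_nonneg_right h2 (show 0 ≤ 8 * D ^ 2 by positivity)
  unfold consensusConst
  nlinarith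

end constants

/-! ### Functions of independent arguments -/

theorem integrable_inner_of_memLp {Ω : Type*} {mΩ : MeasurableSpace Ω} {Pr : Measure Ω} {n : ℕ}
    {u v : Ω → Vec n} (hu : MemLp u 2 Pr) (hv : MemLp v 2 Pr) :
    Integrable (fun ω => ⟪u ω, v ω⟫_ℝ) Pr := by
  refine ((hu.integrable_norm_pow two_ne_zero).add (hv.integrable_norm_pow two_ne_zero)).mono'
    (hu.1.inner hv.1) (.of_forall fun ω => ?_)
  have h1 := norm_inner_le_norm (𝕜 := ℝ) (u ω) (v ω)
  have h2 := two_mul_le_add_sq ‖u ω‖ ‖v ω‖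
  have h3 : 0 ≤ ‖u ω‖ * ‖v ω‖ := by positivity
  simp only [Pi.add_apply]
  linarith

section freeze

variable {Ω E Ξ : Type*} {m mΩ : MeasurableSpace Ω} [MeasurableSpace E] [MeasurableSpace Ξ]
  {Pr : Measure Ω} [IsProbabilityMeasure Pr] {μ : Measure Ξ} {X : Ω → E} {Y : Ω → Ξ} {n : ℕ}

theorem map_prodMk_eq_prod_of_indep (hm : m ≤ mΩ) (hX : Measurable[m] X)
    (hY : Measurable Y) (hlaw : Pr.map Y = μ)
    (hind : Indep (MeasurableSpace.comap Y inferInstance) m Pr) :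
    Pr.map (fun ω => (X ω, Y ω)) = (Pr.map X).prod μ := by
  have hXY : IndepFun X Y Pr := by
    rw [IndepFun_iff_Indep]
    exact indep_of_indep_of_le_left hind.symm hX.comap_le
  rw [← hlaw]
  exact (indepFun_iff_map_prod_eq_prod_map_map (hX.mono hm le_rfl).aemeasurable
    hY.aemeasurable).1 hXY

/-- By independence the joint law of `X` and `Y` is a product, so Fubini allows `X` to be frozen and
the pointwise bound integrated. Integrability comes from the same bound. -/
theorem second_moment_of_indep [IsProbabilityMeasure μ] (hm : m ≤ mΩ) (hX : Measurable[m] X)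
    (hY : Measurable Y) (hlaw : Pr.map Y = μ)
    (hind : Indep (MeasurableSpace.comap Y inferInstance) m Pr)
    {f : E → Ξ → Vec n} (hf : Measurable (Function.uncurry f)) (hf2 : ∀ x, MemLp (f x) 2 μ)
    {h : E → ℝ} (hh : Measurable h) (hfh : ∀ x, ∫ w, ‖f x w‖ ^ 2 ∂μ ≤ h x)
    (hhX : Integrable (fun ω => h (X ω)) Pr) :
    MemLp (fun ω => f (X ω) (Y ω)) 2 Pr ∧
      ∫ ω, ‖f (X ω) (Y ω)‖ ^ 2 ∂Pr ≤ ∫ ω, h (X ω) ∂Pr := by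
  have hX' : Measurable X := hX.mono hm le_rfl
  have hXY : Measurable fun ω => (X ω, Y ω) := hX'.prodMk hY
  have hmap := map_prodMk_eq_prod_of_indep hm hX hY hlaw hind
  have : IsProbabilityMeasure (Pr.map X) := Measure.isProbabilityMeasure_map hX'.aemeasurable
  have hq : Measurable fun p : E × Ξ => ‖f p.1 p.2‖ ^ 2 := hf.norm.pow_const 2
  have hhi : Integrable h (Pr.map X) :=
    (integrable_map_measure hh.aestronglyMeasurable hX'.aemeasurable).2 hhX
  have hint : Integrable (fun p : E × Ξ => ‖f p.1 p.2‖ ^ 2) ((Pr.map X).prod μ) := by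
    refine (integrable_prod_iff hq.aestronglyMeasurable).2 ⟨.of_forall fun x => ?_, ?_⟩
    · exact (hf2 x).integrable_norm_pow two_ne_zero
    · refine hhi.mono' ?_ (.of_forall fun x => ?_)
      · exact hq.aestronglyMeasurable.norm.integral_prod_right'
      · have h0 : (0 : ℝ) ≤ ∫ w, ‖f x w‖ ^ 2 ∂μ := integral_nonneg fun w => by positivity
        simpa [abs_of_nonneg h0] using hfh x
  constructor
  · have hfm : Measurable fun ω => f (X ω) (Y ω) := hf.comp hXY
    refine (memLp_two_iff_integrable_sq_norm hfm.aestronglyMeasurable).2 ?_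
    rw [← hmap] at hint
    exact hint.comp_measurable hXY
  · calc ∫ ω, ‖f (X ω) (Y ω)‖ ^ 2 ∂Pr
        = ∫ p, ‖f p.1 p.2‖ ^ 2 ∂((Pr.map X).prod μ) := by
          rw [← hmap, integral_map hXY.aemeasurable hq.aestronglyMeasurable]
      _ = ∫ x, ∫ w, ‖f x w‖ ^ 2 ∂μ ∂(Pr.map X) := integral_prod _ hint
      _ ≤ ∫ x, h x ∂(Pr.map X) := integral_mono hint.integral_prod_left hhi hfh
      _ = ∫ ω, h (X ω) ∂Pr := integral_map hX'.aemeasurable hh.aestronglyMeasurable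

/-- A substitute for conditional expectation: the test vector `U` is frozen together with `X`, and
integrating out `Y` replaces the oracle value by its mean. -/
theorem integral_inner_of_indep [IsProbabilityMeasure μ] (hm : m ≤ mΩ) (hX : Measurable[m] X)
    (hY : Measurable Y) (hlaw : Pr.map Y = μ)
    (hind : Indep (MeasurableSpace.comap Y inferInstance) m Pr)
    {f : E → Ξ → Vec n} (hf : Measurable (Function.uncurry f)) (hf2 : ∀ x, MemLp (f x) 2 μ)
    (hfXY : MemLp (fun ω => f (X ω) (Y ω)) 2 Pr)
    {U : Ω → Vec n} (hU : Measurable[m] U) (hU2 : MemLp U 2 Pr) :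
    Integrable (fun ω => ⟪U ω, ∫ w, f (X ω) w ∂μ⟫_ℝ) Pr ∧
      ∫ ω, ⟪U ω, f (X ω) (Y ω)⟫_ℝ ∂Pr = ∫ ω, ⟪U ω, ∫ w, f (X ω) w ∂μ⟫_ℝ ∂Pr := by
  have hZ : Measurable[m] fun ω => (U ω, X ω) := hU.prodMk hX
  have hZ' : Measurable fun ω => (U ω, X ω) := hZ.mono hm le_rfl
  have hZY : Measurable fun ω => ((U ω, X ω), Y ω) := hZ'.prodMk hY
  have hmap := map_prodMk_eq_prod_of_indep hm hZ hY hlaw hind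
  have : IsProbabilityMeasure (Pr.map fun ω => (U ω, X ω)) :=
    Measure.isProbabilityMeasure_map hZ'.aemeasurable
  have hF : Measurable fun p : (Vec n × E) × Ξ => f p.1.2 p.2 :=
    hf.comp ((measurable_snd.comp measurable_fst).prodMk measurable_snd)
  have hq : Measurable fun p : (Vec n × E) × Ξ => ⟪p.1.1, f p.1.2 p.2⟫_ℝ :=
    (measurable_fst.comp measurable_fst).inner hF
  have hint : Integrable (fun p : (Vec n × E) × Ξ => ⟪p.1.1, f p.1.2 p.2⟫_ℝ)
      ((Pr.map fun ω => (U ω, X ω)).prod μ) := by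
    rw [← hmap, integrable_map_measure hq.aestronglyMeasurable hZY.aemeasurable]
    exact integrable_inner_of_memLp hU2 hfXY
  have hin : ∀ p : Vec n × E, ∫ w, ⟪p.1, f p.2 w⟫_ℝ ∂μ = ⟪p.1, ∫ w, f p.2 w ∂μ⟫_ℝ :=
    fun p => integral_inner ((hf2 p.2).integrable one_le_two) p.1
  have hI := hint.integral_prod_left
  simp only [hin] at hI
  refine ⟨hI.comp_measurable hZ', ?_⟩
  calc ∫ ω, ⟪U ω, f (X ω) (Y ω)⟫_ℝ ∂Pr
      = ∫ p, ⟪p.1.1, f p.1.2 p.2⟫_ℝ ∂((Pr.map fun ω => (U ω, X ω)).prod μ) := by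
        rw [← hmap, integral_map hZY.aemeasurable hq.aestronglyMeasurable]
    _ = ∫ p : Vec n × E, ⟪p.1, ∫ w, f p.2 w ∂μ⟫_ℝ ∂(Pr.map fun ω => (U ω, X ω)) := by
        rw [integral_prod _ hint]
        simp only [hin]
    _ = ∫ ω, ⟪U ω, ∫ w, f (X ω) w ∂μ⟫_ℝ ∂Pr :=
        integral_map hZ'.aemeasurable hI.aestronglyMeasurable

end freeze

/-! ### The compressor -/

theorem norm_convex_comb_sq_le {E : Type*} [NormedAddCommGroup E] [InnerProductSpace ℝ E]
    {q : ℝ} (hq0 : 0 ≤ q) (hq1 : q ≤ 1) (u v : E) :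
    ‖(1 - q) • u + q • v‖ ^ 2 ≤ (1 - q) * ‖u‖ ^ 2 + q * ‖v‖ ^ 2 := by
  have h1 : ‖(1 - q) • u + q • v‖ ≤ (1 - q) * ‖u‖ + q * ‖v‖ := by
    refine (norm_add_le _ _).trans_eq ?_
    rw [norm_smul, norm_smul, Real.norm_of_nonneg hq0, Real.norm_of_nonneg (by linarith)]
  have h2 := pow_le_pow_left₀ (norm_nonneg _) h1 2
  nlinarith [mul_nonneg (mul_nonneg hq0 (sub_nonneg.2 hq1)) (sq_nonneg (‖u‖ - ‖v‖))]

section compressor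

variable {n : ℕ} {Θ : Type*} [MeasurableSpace Θ] {ν : Measure Θ} [IsProbabilityMeasure ν]
  {C : Vec n → Θ → Vec n} {r φ δ ψ s : ℝ}

theorem IsCompressor.residual_memLp (hC : IsCompressor ν C r φ δ) (u : Vec n) :
    MemLp (fun w => u - (ψ * s) • C (s⁻¹ • u) w) 2 ν := by
  have h : MemLp (fun w => (ψ * s) • C (s⁻¹ • u) w) 2 ν := (hC.memLp (s⁻¹ • u)).const_smul (ψ * s)
  exact (memLp_const u).sub h

/-- With `u = s v`, the residual is `s` times the convex combination, with weight `ψr`, of `v` and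
the compression error `v - C(v)/r`. Convexity of the squared norm gives the factor `(1 - ψr) + ψr(1
- φ)`. -/
theorem IsCompressor.residual_le (hC : IsCompressor ν C r φ δ) (hr : 0 < r) (hψ : 0 ≤ ψ)
    (hψr : ψ * r ≤ 1) (hs : 0 < s) (u : Vec n) :
    ∫ w, ‖u - (ψ * s) • C (s⁻¹ • u) w‖ ^ 2 ∂ν
      ≤ (1 - ψ * r * φ) * ‖u‖ ^ 2 + ψ * r * δ ^ 2 * s ^ 2 := by
  obtain ⟨v, hv⟩ : ∃ v, v = s⁻¹ • u := ⟨_, rfl⟩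
  rw [← hv]
  have hu : u = s • v := by rw [hv, smul_smul, mul_inv_cancel₀ hs.ne', one_smul]
  have hq : 0 ≤ ψ * r := by positivity
  have hL : MemLp (fun w => r⁻¹ • C v w - v) 2 ν := by
    have h : MemLp (fun w => r⁻¹ • C v w) 2 ν := (hC.memLp v).const_smul r⁻¹
    exact h.sub (memLp_const v)
  have hI : Integrable (fun w => ‖r⁻¹ • C v w - v‖ ^ 2) ν := hL.integrable_norm_pow two_ne_zero
  have hLu : Integrable (fun w => ‖u - (ψ * s) • C v w‖ ^ 2) ν := by
    have h := hC.residual_memLp (ψ := ψ) (s := s) u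
    rw [← hv] at h
    exact h.integrable_norm_pow two_ne_zero
  have hpt : ∀ w, ‖u - (ψ * s) • C v w‖ ^ 2
      ≤ s ^ 2 * ((1 - ψ * r) * ‖v‖ ^ 2 + ψ * r * ‖r⁻¹ • C v w - v‖ ^ 2) := by
    intro w
    have h1 : u - (ψ * s) • C v w
        = s • ((1 - ψ * r) • v + (ψ * r) • (-(r⁻¹ • C v w - v))) := by
      have : ψ * r * r⁻¹ = ψ := by field_simp
      rw [hu, smul_neg, smul_sub, smul_smul, this]
      module
    rw [h1, norm_smul, mul_pow, Real.norm_eq_abs, sq_abs]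
    have := norm_convex_comb_sq_le hq hψr v (-(r⁻¹ • C v w - v))
    rw [norm_neg] at this
    gcongr
  have hR : Integrable
      (fun w => s ^ 2 * ((1 - ψ * r) * ‖v‖ ^ 2 + ψ * r * ‖r⁻¹ • C v w - v‖ ^ 2)) ν :=
    ((integrable_const _).add (hI.const_mul _)).const_mul _
  have hu2 : ‖u‖ ^ 2 = s ^ 2 * ‖v‖ ^ 2 := by
    rw [hu, norm_smul, mul_pow, Real.norm_eq_abs, sq_abs]
  calc ∫ w, ‖u - (ψ * s) • C v w‖ ^ 2 ∂ν
      ≤ ∫ w, s ^ 2 * ((1 - ψ * r) * ‖v‖ ^ 2 + ψ * r * ‖r⁻¹ • C v w - v‖ ^ 2) ∂ν :=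
        integral_mono hLu hR hpt
    _ = s ^ 2 * ((1 - ψ * r) * ‖v‖ ^ 2 + ψ * r * ∫ w, ‖r⁻¹ • C v w - v‖ ^ 2 ∂ν) := by
        rw [integral_const_mul, integral_add (integrable_const _) (hI.const_mul _),
          integral_const_mul (ψ * r)]
        simp
    _ ≤ s ^ 2 * ((1 - ψ * r) * ‖v‖ ^ 2 + ψ * r * ((1 - φ) * ‖v‖ ^ 2 + δ ^ 2)) := by
        gcongr
        exact hC.error v
    _ = _ := by rw [hu2]; ring

end compressor

/-! ### Square integrable trajectories -/

/-- The properties of a trajectory `x`, with estimates `y` and oracle increments `g`, that the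
consensus and descent estimates rest on: the recursion, square integrability, the second moment
bound of the increments, and the contraction of the estimation error by the compressor. -/
structure IsTrajectory {N n : ℕ} {Ω : Type*} [MeasurableSpace Ω] (Pr : Measure Ω)
    (W : Matrix (Fin N) (Fin N) ℝ) (γ p q D : ℝ) (η : ℕ → ℝ) (I : Set ℕ)
    (x y g : ℕ → Fin N → Ω → Vec n) : Prop where
  x_zero : ∀ i ω, x 0 i ω = 0
  y_zero : ∀ i ω, y 0 i ω = 0
  step_comm : ∀ t, t + 1 ∈ I → ∀ i ω,
    x (t + 1) i ω = x t i ω + η t • g t i ω - γ • matAct (1 - W) (fun j => y t j ω) i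
  step_local : ∀ t, t + 1 ∉ I → ∀ i ω, x (t + 1) i ω = x t i ω + η t • g t i ω
  estimate_local : ∀ t, t + 1 ∉ I → ∀ i ω, y (t + 1) i ω = y t i ω
  memLp_x : ∀ t i, MemLp (x t i) 2 Pr
  memLp_y : ∀ t i, MemLp (y t i) 2 Pr
  memLp_g : ∀ t i, MemLp (g t i) 2 Pr
  increment_le : ∀ t i, ∫ ω, ‖g t i ω‖ ^ 2 ∂Pr ≤ D ^ 2
  estimate_comm : ∀ t, t + 1 ∈ I → ∀ i,
    ∫ ω, ‖x (t + 1) i ω - y (t + 1) i ω‖ ^ 2 ∂Pr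
      ≤ (1 - p) * ∫ ω, ‖x (t + 1) i ω - y t i ω‖ ^ 2 ∂Pr + q * η t ^ 2

section run

variable {N n : ℕ} {Ω Θ : Type*} {Ξ : Fin N → Type*}
  {W : Matrix (Fin N) (Fin N) ℝ} {γ ψ : ℝ} {η s : ℕ → ℝ} {I : Set ℕ}
  {Ft : (i : Fin N) → Vec n → Ξ i → Vec n} {C : Vec n → Θ → Vec n}
  {ξ : ℕ → (i : Fin N) → Ω → Ξ i} {θ : ℕ → Fin N → Ω → Θ}

theorem run_succ_x_of_mem {t : ℕ} (h : t + 1 ∈ I) (i : Fin N) (ω : Ω) :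
    (run W γ ψ η s I Ft C ξ θ (t + 1) ω).x i
      = mixStep W γ (localStep (η t) (run W γ ψ η s I Ft C ξ θ t ω).x fun i =>
          Ft i ((run W γ ψ η s I Ft C ξ θ t ω).x i) (ξ t i ω))
          (run W γ ψ η s I Ft C ξ θ t ω).xhat i := by
  rw [run]
  simp only [h, if_true]

theorem run_succ_xhat_of_mem {t : ℕ} (h : t + 1 ∈ I) (i : Fin N) (ω : Ω) :
    (run W γ ψ η s I Ft C ξ θ (t + 1) ω).xhat i
      = (run W γ ψ η s I Ft C ξ θ t ω).xhat i + (ψ * s t) • C ((s t)⁻¹ •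
          ((run W γ ψ η s I Ft C ξ θ (t + 1) ω).x i - (run W γ ψ η s I Ft C ξ θ t ω).xhat i))
          (θ t i ω) := by
  rw [run_succ_x_of_mem h]
  conv_lhs => rw [run]
  simp only [h, if_true]

theorem run_succ_x_of_notMem {t : ℕ} (h : t + 1 ∉ I) (i : Fin N) (ω : Ω) :
    (run W γ ψ η s I Ft C ξ θ (t + 1) ω).x i
      = localStep (η t) (run W γ ψ η s I Ft C ξ θ t ω).x (fun i =>
          Ft i ((run W γ ψ η s I Ft C ξ θ t ω).x i) (ξ t i ω)) i := by
  rw [run]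
  simp only [h, if_false]

theorem run_succ_xhat_of_notMem {t : ℕ} (h : t + 1 ∉ I) (i : Fin N) (ω : Ω) :
    (run W γ ψ η s I Ft C ξ θ (t + 1) ω).xhat i = (run W γ ψ η s I Ft C ξ θ t ω).xhat i := by
  rw [run]
  simp only [h, if_false]

theorem localStep_eq (c : ℝ) (x g : Fin N → Vec n) (i : Fin N) :
    localStep c x g i = x i + c • (g i - x i) := by
  rw [localStep]
  module

variable [MeasurableSpace Θ] [∀ i, MeasurableSpace (Ξ i)]

theorem history_le_succ (t : ℕ) : history ξ θ t ≤ history ξ θ (t + 1) :=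
  iSup_le fun u => le_iSup
    (fun u : Fin (t + 1) => ⨆ i : Fin N, MeasurableSpace.comap (ξ u i) inferInstance ⊔
      MeasurableSpace.comap (θ u i) inferInstance) u.castSucc

theorem comap_sample_le_history (t : ℕ) (i : Fin N) :
    MeasurableSpace.comap (ξ t i) inferInstance ≤ history ξ θ (t + 1) :=
  le_iSup_of_le (Fin.last t) (le_iSup_of_le i le_sup_left)

theorem comap_compress_le_history (t : ℕ) (i : Fin N) :
    MeasurableSpace.comap (θ t i) inferInstance ≤ history ξ θ (t + 1) :=
  le_iSup_of_le (Fin.last t) (le_iSup_of_le i le_sup_right)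

theorem historyWithSamples_le_history (t : ℕ) :
    historyWithSamples ξ θ t ≤ history ξ θ (t + 1) :=
  sup_le (history_le_succ t) (iSup_le fun i => comap_sample_le_history t i)

theorem measurable_sample_historyWithSamples (t : ℕ) (i : Fin N) :
    Measurable[historyWithSamples ξ θ t] (ξ t i) :=
  measurable_iff_comap_le.2 (le_sup_of_le_right
    (le_iSup (fun i => MeasurableSpace.comap (ξ t i) inferInstance) i))

theorem measurable_localStep {m : MeasurableSpace Ω} {x : Ω → Fin N → Vec n}
    {w : (i : Fin N) → Ω → Ξ i} (c : ℝ) (hFt : ∀ i, Measurable (Function.uncurry (Ft i)))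
    (hx : ∀ i, Measurable fun ω => x ω i) (hw : ∀ i, Measurable (w i)) (i : Fin N) :
    Measurable fun ω => localStep c (x ω) (fun i => Ft i (x ω i) (w i ω)) i :=
  ((hx i).const_smul (1 - c)).add (((hFt i).comp ((hx i).prodMk (hw i))).const_smul c)

theorem measurable_mixStep {m : MeasurableSpace Ω} {z y : Ω → Fin N → Vec n} (W γ)
    (hz : ∀ i, Measurable fun ω => z ω i) (hy : ∀ i, Measurable fun ω => y ω i) (i : Fin N) :
    Measurable fun ω => mixStep W γ (z ω) (y ω) i :=
  (hz i).add ((Finset.measurable_sum _ fun j _ =>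
    ((hy j).sub (hy i)).const_smul (W i j)).const_smul γ)

/-- The new iterate uses the samples of iteration `t` but not its compressor randomness. This finer
measurability is what makes the compressor noise independent of the vector it compresses. -/
theorem measurable_run_succ_x (hFt : ∀ i, Measurable (Function.uncurry (Ft i))) {t : ℕ}
    (hx : ∀ i, Measurable[history ξ θ t] fun ω => (run W γ ψ η s I Ft C ξ θ t ω).x i)
    (hy : ∀ i, Measurable[history ξ θ t] fun ω => (run W γ ψ η s I Ft C ξ θ t ω).xhat i)
    (i : Fin N) :
    Measurable[historyWithSamples ξ θ t] fun ω => (run W γ ψ η s I Ft C ξ θ (t + 1) ω).x i := by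
  have hx' := fun i => (hx i).mono (le_sup_left : history ξ θ t ≤ historyWithSamples ξ θ t) le_rfl
  have hy' := fun i => (hy i).mono (le_sup_left : history ξ θ t ≤ historyWithSamples ξ θ t) le_rfl
  have hz := measurable_localStep (η t) hFt hx' (measurable_sample_historyWithSamples t)
  by_cases h : t + 1 ∈ I
  · simp_rw [run_succ_x_of_mem h]
    exact measurable_mixStep W γ hz hy' i
  · simp_rw [run_succ_x_of_notMem h]
    exact hz i

theorem measurable_run (hFt : ∀ i, Measurable (Function.uncurry (Ft i)))
    (hC : Measurable (Function.uncurry C)) (t : ℕ) :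
    (∀ i, Measurable[history ξ θ t] fun ω => (run W γ ψ η s I Ft C ξ θ t ω).x i) ∧
      ∀ i, Measurable[history ξ θ t] fun ω => (run W γ ψ η s I Ft C ξ θ t ω).xhat i := by
  induction t with
  | zero => exact ⟨fun i => measurable_const, fun i => measurable_const⟩
  | succ t ih =>
    obtain ⟨hx, hy⟩ := ih
    have hx' : ∀ i, Measurable[history ξ θ (t + 1)]
        fun ω => (run W γ ψ η s I Ft C ξ θ (t + 1) ω).x i := fun i =>
      (measurable_run_succ_x hFt hx hy i).mono (historyWithSamples_le_history t) le_rfl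
    have hy' := fun i => (hy i).mono (history_le_succ (ξ := ξ) (θ := θ) t) le_rfl
    refine ⟨hx', fun i => ?_⟩
    by_cases h : t + 1 ∈ I
    · simp_rw [run_succ_xhat_of_mem h]
      have hθ : Measurable[history ξ θ (t + 1)] (θ t i) :=
        measurable_iff_comap_le.2 (comap_compress_le_history t i)
      exact (hy' i).add ((hC.comp ((((hx' i).sub (hy' i)).const_smul (s t)⁻¹).prodMk
        hθ)).const_smul (ψ * s t))
    · simp_rw [run_succ_xhat_of_notMem h]
      exact hy' i

variable [mΩ : MeasurableSpace Ω] {Pr : Measure Ω}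
  {μ : (i : Fin N) → Measure (Ξ i)} {ν : Measure Θ}

theorem IsFreshNoise.history_le (h : IsFreshNoise Pr μ ν ξ θ) (t : ℕ) : history ξ θ t ≤ mΩ :=
  iSup_le fun u => iSup_le fun i =>
    sup_le (h.measurable_sample u i).comap_le (h.measurable_compress u i).comap_le

theorem IsFreshNoise.historyWithSamples_le (h : IsFreshNoise Pr μ ν ξ θ) (t : ℕ) :
    historyWithSamples ξ θ t ≤ mΩ :=
  sup_le (h.history_le t) (iSup_le fun i => (h.measurable_sample t i).comap_le)

theorem memLp_matAct {A : Matrix (Fin N) (Fin N) ℝ} {v : Fin N → Ω → Vec n}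
    (hv : ∀ i, MemLp (v i) 2 Pr) (i : Fin N) :
    MemLp (fun ω => matAct A (fun j => v j ω) i) 2 Pr :=
  memLp_finsetSum _ fun j _ => (hv j).const_smul (A i j)

variable [IsProbabilityMeasure Pr] {F : Fin N → Vec n → Vec n}
  {β P σ M D r φ δ : ℝ}

theorem IsBiasedOracle.increment [∀ i, IsProbabilityMeasure (μ i)]
    (hFt : ∀ i, IsBiasedOracle (μ i) (F i) (Ft i) β P σ M D)
    (hnoise : IsFreshNoise Pr μ ν ξ θ) {t : ℕ} {x : Fin N → Ω → Vec n}
    (hx : ∀ i, Measurable[history ξ θ t] (x i)) (i : Fin N) :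
    MemLp (fun ω => Ft i (x i ω) (ξ t i ω) - x i ω) 2 Pr ∧
      ∫ ω, ‖Ft i (x i ω) (ξ t i ω) - x i ω‖ ^ 2 ∂Pr ≤ D ^ 2 := by
  have h := second_moment_of_indep (hnoise.history_le t) (hx i) (hnoise.measurable_sample t i)
    (hnoise.law_sample t i) (hnoise.indep_sample t i) (f := fun v w => Ft i v w - v)
    ((hFt i).measurable.sub measurable_fst) (fun v => ((hFt i).memLp v).sub (memLp_const v))
    (h := fun _ => D ^ 2) measurable_const (hFt i).second_moment (integrable_const _)
  simpa using h

theorem IsBiasedOracle.integral_inner_increment [∀ i, IsProbabilityMeasure (μ i)]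
    (hFt : ∀ i, IsBiasedOracle (μ i) (F i) (Ft i) β P σ M D)
    (hnoise : IsFreshNoise Pr μ ν ξ θ) {t : ℕ} {x : Fin N → Ω → Vec n}
    (hx : ∀ i, Measurable[history ξ θ t] (x i)) {U : Ω → Vec n}
    (hU : Measurable[history ξ θ t] U) (hU2 : MemLp U 2 Pr) (i : Fin N) :
    Integrable (fun ω => ⟪U ω, ∫ w, (Ft i (x i ω) w - x i ω) ∂(μ i)⟫_ℝ) Pr ∧
      ∫ ω, ⟪U ω, Ft i (x i ω) (ξ t i ω) - x i ω⟫_ℝ ∂Pr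
        = ∫ ω, ⟪U ω, ∫ w, (Ft i (x i ω) w - x i ω) ∂(μ i)⟫_ℝ ∂Pr :=
  integral_inner_of_indep (hnoise.history_le t) (hx i) (hnoise.measurable_sample t i)
    (hnoise.law_sample t i) (hnoise.indep_sample t i) (f := fun v w => Ft i v w - v)
    ((hFt i).measurable.sub measurable_fst) (fun v => ((hFt i).memLp v).sub (memLp_const v))
    (IsBiasedOracle.increment hFt hnoise hx i).1 hU hU2

theorem IsCompressor.residual_process [IsProbabilityMeasure ν]
    (hC : IsCompressor ν C r φ δ) (hr : 0 < r) (hψ : 0 ≤ ψ)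
    (hψr : ψ * r ≤ 1) {c : ℝ} (hc : 0 < c) (hnoise : IsFreshNoise Pr μ ν ξ θ) {t : ℕ}
    {u : Ω → Vec n} (hu : Measurable[historyWithSamples ξ θ t] u) (hu2 : MemLp u 2 Pr)
    (i : Fin N) :
    MemLp (fun ω => u ω - (ψ * c) • C (c⁻¹ • u ω) (θ t i ω)) 2 Pr ∧
      ∫ ω, ‖u ω - (ψ * c) • C (c⁻¹ • u ω) (θ t i ω)‖ ^ 2 ∂Pr
        ≤ (1 - ψ * r * φ) * ∫ ω, ‖u ω‖ ^ 2 ∂Pr + ψ * r * δ ^ 2 * c ^ 2 := by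
  have hI : Integrable (fun ω => ‖u ω‖ ^ 2) Pr := hu2.integrable_norm_pow two_ne_zero
  have h := second_moment_of_indep (hnoise.historyWithSamples_le t) hu
    (hnoise.measurable_compress t i) (hnoise.law_compress t i) (hnoise.indep_compress t i)
    (f := fun v w => v - (ψ * c) • C (c⁻¹ • v) w)
    (measurable_fst.sub ((hC.measurable.comp
      ((measurable_fst.const_smul c⁻¹).prodMk measurable_snd)).const_smul (ψ * c)))
    (fun v => hC.residual_memLp v)
    (h := fun v => (1 - ψ * r * φ) * ‖v‖ ^ 2 + ψ * r * δ ^ 2 * c ^ 2)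
    (((measurable_norm.pow_const 2).const_mul _).add_const _)
    (fun v => hC.residual_le hr hψ hψr hc v) ((hI.const_mul _).add (integrable_const _))
  refine ⟨h.1, h.2.trans_eq ?_⟩
  rw [integral_add (hI.const_mul _) (integrable_const _), integral_const_mul]
  simp

theorem IsMixingMatrix.isTrajectory_run [∀ i, IsProbabilityMeasure (μ i)]
    [IsProbabilityMeasure ν] {G : Digraph (Fin N)} (hW : IsMixingMatrix G W)
    (hFt : ∀ i, IsBiasedOracle (μ i) (F i) (Ft i) β P σ M D) (hC : IsCompressor ν C r φ δ)
    (hr : 0 < r) (hψ : 0 ≤ ψ) (hψr : ψ * r ≤ 1) (hη : ∀ t, 0 < η t)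
    (hnoise : IsFreshNoise Pr μ ν ξ θ) :
    IsTrajectory Pr W γ (ψ * r * φ) (ψ * r * δ ^ 2) D η I
      (fun t i ω => (run W γ ψ η η I Ft C ξ θ t ω).x i)
      (fun t i ω => (run W γ ψ η η I Ft C ξ θ t ω).xhat i)
      (fun t i ω => Ft i ((run W γ ψ η η I Ft C ξ θ t ω).x i) (ξ t i ω)
        - (run W γ ψ η η I Ft C ξ θ t ω).x i) := by
  have hmeas := measurable_run (W := W) (γ := γ) (ψ := ψ) (η := η) (s := η) (I := I) (ξ := ξ)
    (θ := θ) (fun i => (hFt i).measurable) hC.measurable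
  have hg := fun t i => IsBiasedOracle.increment hFt hnoise (hmeas t).1 i
  have hstep : ∀ t, t + 1 ∈ I → ∀ i ω, (run W γ ψ η η I Ft C ξ θ (t + 1) ω).x i
      = (run W γ ψ η η I Ft C ξ θ t ω).x i
        + η t • (Ft i ((run W γ ψ η η I Ft C ξ θ t ω).x i) (ξ t i ω)
          - (run W γ ψ η η I Ft C ξ θ t ω).x i)
        - γ • matAct (1 - W) (run W γ ψ η η I Ft C ξ θ t ω).xhat i := by
    intro t ht i ω
    rw [run_succ_x_of_mem ht, hW.mixStep_eq, localStep_eq]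
  have hstep' : ∀ t, t + 1 ∉ I → ∀ i ω, (run W γ ψ η η I Ft C ξ θ (t + 1) ω).x i
      = (run W γ ψ η η I Ft C ξ θ t ω).x i
        + η t • (Ft i ((run W γ ψ η η I Ft C ξ θ t ω).x i) (ξ t i ω)
          - (run W γ ψ η η I Ft C ξ θ t ω).x i) := by
    intro t ht i ω
    rw [run_succ_x_of_notMem ht, localStep_eq]
  have hcomp : ∀ t, t + 1 ∈ I → ∀ i,
      MemLp (fun ω => (run W γ ψ η η I Ft C ξ θ (t + 1) ω).x i
        - (run W γ ψ η η I Ft C ξ θ t ω).xhat i) 2 Pr →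
      MemLp (fun ω => (run W γ ψ η η I Ft C ξ θ (t + 1) ω).x i
        - (run W γ ψ η η I Ft C ξ θ (t + 1) ω).xhat i) 2 Pr ∧
      ∫ ω, ‖(run W γ ψ η η I Ft C ξ θ (t + 1) ω).x i
          - (run W γ ψ η η I Ft C ξ θ (t + 1) ω).xhat i‖ ^ 2 ∂Pr
        ≤ (1 - ψ * r * φ) * ∫ ω, ‖(run W γ ψ η η I Ft C ξ θ (t + 1) ω).x i
          - (run W γ ψ η η I Ft C ξ θ t ω).xhat i‖ ^ 2 ∂Pr + ψ * r * δ ^ 2 * η t ^ 2 := by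
    intro t ht i hL
    have h := hC.residual_process hr hψ hψr (hη t) hnoise
      ((measurable_run_succ_x (fun i => (hFt i).measurable) (hmeas t).1 (hmeas t).2 i).sub
        (((hmeas t).2 i).mono le_sup_left le_rfl)) hL i
    simpa only [run_succ_xhat_of_mem ht i, sub_add_eq_sub_sub, Pi.sub_apply] using h
  have hLp : ∀ t, (∀ i, MemLp (fun ω => (run W γ ψ η η I Ft C ξ θ t ω).x i) 2 Pr) ∧
      ∀ i, MemLp (fun ω => (run W γ ψ η η I Ft C ξ θ t ω).xhat i) 2 Pr := by
    intro t
    induction t with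
    | zero => exact ⟨fun i => memLp_const 0, fun i => memLp_const 0⟩
    | succ t ih =>
      obtain ⟨hx, hy⟩ := ih
      have hz : ∀ i, MemLp (fun ω => (run W γ ψ η η I Ft C ξ θ t ω).x i
        + η t • (Ft i ((run W γ ψ η η I Ft C ξ θ t ω).x i) (ξ t i ω)
          - (run W γ ψ η η I Ft C ξ θ t ω).x i)) 2 Pr := fun i =>
        (hx i).add ((hg t i).1.const_smul (η t))
      by_cases h : t + 1 ∈ I
      · have hx' : ∀ i, MemLp (fun ω => (run W γ ψ η η I Ft C ξ θ (t + 1) ω).x i) 2 Pr := by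
          intro i
          simp_rw [hstep t h]
          exact (hz i).sub ((memLp_matAct hy i).const_smul γ)
        refine ⟨hx', fun i => ?_⟩
        -- The new estimate is recovered as the new iterate minus the compression residual, both
        -- square integrable.
        have h3 := (hx' i).sub (hcomp t h i ((hx' i).sub (hy i))).1
        refine h3.ae_eq (.of_forall fun ω => ?_)
        simp
      · refine ⟨fun i => ?_, fun i => ?_⟩
        · simp_rw [hstep' t h]
          exact hz i
        · simp_rw [run_succ_xhat_of_notMem h]
          exact hy i
  exact
    { x_zero := fun i ω => rfl
      y_zero := fun i ω => rfl
      step_comm := hstep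
      step_local := hstep'
      estimate_local := fun t ht i ω => run_succ_xhat_of_notMem ht i ω
      memLp_x := fun t i => (hLp t).1 i
      memLp_y := fun t i => (hLp t).2 i
      memLp_g := fun t i => (hg t i).1
      increment_le := fun t i => (hg t i).2
      estimate_comm := fun t ht i =>
        (hcomp t ht i (((hLp (t + 1)).1 i).sub ((hLp t).2 i))).2 }

end run

/-! ### The consensus error in expectation -/

section consensus

variable {N n H : ℕ} {Ω : Type*} [MeasurableSpace Ω] {Pr : Measure Ω}
  {x y g : ℕ → Fin N → Ω → Vec n} {η : ℕ → ℝ} {I : Set ℕ} {W : Matrix (Fin N) (Fin N) ℝ}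
  {γ p q D : ℝ}

/-- The expected total squared distance of the agents to their average. -/
def disagreement (Pr : Measure Ω) (x : ℕ → Fin N → Ω → Vec n) (t : ℕ) : ℝ :=
  ∫ ω, ∑ i, ‖x t i ω - avg fun j => x t j ω‖ ^ 2 ∂Pr

/-- The expected total squared error of the estimates. -/
def estimateError (Pr : Measure Ω) (x y : ℕ → Fin N → Ω → Vec n) (t : ℕ) : ℝ :=
  ∫ ω, ∑ i, ‖x t i ω - y t i ω‖ ^ 2 ∂Pr

/-- The weighted sum of the increments in the iterations from `τ` to `t - 1`. -/
def accumulated (η : ℕ → ℝ) (g : ℕ → Fin N → Ω → Vec n) (τ t : ℕ) (i : Fin N) (ω : Ω) : Vec n :=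
  ∑ u ∈ Finset.Ico τ t, η u • g u i ω

theorem memLp_avg {v : Fin N → Ω → Vec n} (hv : ∀ i, MemLp (v i) 2 Pr) :
    MemLp (fun ω => avg fun i => v i ω) 2 Pr :=
  (memLp_finsetSum _ fun i _ => hv i).const_smul (1 / N : ℝ)

theorem integrable_sum_norm_sq {v : Fin N → Ω → Vec n} (hv : ∀ i, MemLp (v i) 2 Pr) :
    Integrable (fun ω => ∑ i, ‖v i ω‖ ^ 2) Pr :=
  integrable_finsetSum _ fun i _ => (hv i).integrable_norm_pow two_ne_zero

theorem memLp_sub_avg {v : Fin N → Ω → Vec n} (hv : ∀ i, MemLp (v i) 2 Pr) (i : Fin N) :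
    MemLp (fun ω => v i ω - avg fun j => v j ω) 2 Pr :=
  (hv i).sub (memLp_avg hv)

theorem memLp_accumulated (hg : ∀ t i, MemLp (g t i) 2 Pr) (η : ℕ → ℝ) (τ t : ℕ) (i : Fin N) :
    MemLp (accumulated η g τ t i) 2 Pr :=
  memLp_finsetSum _ fun u _ => (hg u i).const_smul (η u)

/-- One factor `H` comes from Cauchy-Schwarz over the window and the other from its number of terms;
the increments need not be independent or centred. -/
theorem integral_sum_accumulated_le (hg : ∀ t i, MemLp (g t i) 2 Pr)
    (hD : ∀ t i, ∫ ω, ‖g t i ω‖ ^ 2 ∂Pr ≤ D ^ 2) (hη : ∀ t, 0 ≤ η t) (hanti : Antitone η)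
    {τ t : ℕ} (hH : t ≤ τ + H) :
    ∫ ω, ∑ i, ‖accumulated η g τ t i ω‖ ^ 2 ∂Pr ≤ N * D ^ 2 * H ^ 2 * η τ ^ 2 := by
  have hgi : ∀ u i, Integrable (fun ω => ‖g u i ω‖ ^ 2) Pr := fun u i =>
    (hg u i).integrable_norm_pow two_ne_zero
  have hcard : ((Finset.Ico τ t).card : ℝ) ≤ H := by
    rw [Nat.card_Ico]
    exact_mod_cast Nat.sub_le_iff_le_add'.2 hH
  have hpt : ∀ i ω, ‖accumulated η g τ t i ω‖ ^ 2
      ≤ H * η τ ^ 2 * ∑ u ∈ Finset.Ico τ t, ‖g u i ω‖ ^ 2 := by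
    intro i ω
    calc ‖accumulated η g τ t i ω‖ ^ 2
        ≤ (Finset.Ico τ t).card * ∑ u ∈ Finset.Ico τ t, ‖η u • g u i ω‖ ^ 2 :=
          norm_sum_sq_le_card_mul _ _
      _ ≤ H * ∑ u ∈ Finset.Ico τ t, η τ ^ 2 * ‖g u i ω‖ ^ 2 := by
          gcongr with u hu
          rw [norm_smul, mul_pow, Real.norm_of_nonneg (hη u)]
          have := hanti (Finset.mem_Ico.1 hu).1
          have := hη u
          gcongr
      _ = _ := by rw [← Finset.mul_sum, mul_assoc]
  have hi : ∀ i, ∫ ω, ‖accumulated η g τ t i ω‖ ^ 2 ∂Pr ≤ D ^ 2 * H ^ 2 * η τ ^ 2 := by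
    intro i
    calc ∫ ω, ‖accumulated η g τ t i ω‖ ^ 2 ∂Pr
        ≤ ∫ ω, H * η τ ^ 2 * ∑ u ∈ Finset.Ico τ t, ‖g u i ω‖ ^ 2 ∂Pr :=
          integral_mono ((memLp_accumulated hg η τ t i).integrable_norm_pow two_ne_zero)
            ((integrable_finsetSum _ fun u _ => hgi u i).const_mul _) (hpt i)
      _ = H * η τ ^ 2 * ∑ u ∈ Finset.Ico τ t, ∫ ω, ‖g u i ω‖ ^ 2 ∂Pr := by
          rw [integral_const_mul, integral_finsetSum _ fun u _ => hgi u i]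
      _ ≤ H * η τ ^ 2 * ∑ u ∈ Finset.Ico τ t, D ^ 2 := by
          gcongr
          exact hD _ _
      _ ≤ H * η τ ^ 2 * (H * D ^ 2) := by
          rw [Finset.sum_const, nsmul_eq_mul]
          gcongr
      _ = _ := by ring
  rw [integral_finsetSum _ fun i _ =>
    (memLp_accumulated hg η τ t i).integrable_norm_pow two_ne_zero]
  calc ∑ i, ∫ ω, ‖accumulated η g τ t i ω‖ ^ 2 ∂Pr ≤ ∑ _i : Fin N, D ^ 2 * H ^ 2 * η τ ^ 2 :=
        Finset.sum_le_sum fun i _ => hi i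
    _ = _ := by
      rw [Finset.sum_const, Finset.card_univ, Fintype.card_fin, nsmul_eq_mul]
      ring

theorem integral_le_linear_comb {A B C Z : Ω → ℝ} {c₁ c₂ c₃ : ℝ} (hZ : Integrable Z Pr)
    (hA : Integrable A Pr) (hB : Integrable B Pr) (hC : Integrable C Pr)
    (h : ∀ ω, Z ω ≤ c₁ * A ω + c₂ * B ω + c₃ * C ω) :
    ∫ ω, Z ω ∂Pr ≤ c₁ * ∫ ω, A ω ∂Pr + c₂ * ∫ ω, B ω ∂Pr + c₃ * ∫ ω, C ω ∂Pr := by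
  have h1 := hA.const_mul c₁
  have h2 := hB.const_mul c₂
  have h3 := hC.const_mul c₃
  have h12 : Integrable (fun ω => c₁ * A ω + c₂ * B ω) Pr := h1.add h2
  refine (integral_mono hZ (h12.add h3) h).trans_eq ?_
  simp only [Pi.add_apply]
  rw [integral_add h12 h3, integral_add h1 h2, integral_const_mul, integral_const_mul,
    integral_const_mul]

theorem disagreement_nonneg (Pr : Measure Ω) (x : ℕ → Fin N → Ω → Vec n) (t : ℕ) :
    0 ≤ disagreement Pr x t :=
  integral_nonneg fun _ => Finset.sum_nonneg fun _ _ => by positivity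

theorem estimateError_nonneg (Pr : Measure Ω) (x y : ℕ → Fin N → Ω → Vec n) (t : ℕ) :
    0 ≤ estimateError Pr x y t :=
  integral_nonneg fun _ => Finset.sum_nonneg fun _ _ => by positivity

theorem disagreement_le_of_accumulated (h : IsTrajectory Pr W γ p q D η I x y g)
    (hN : 1 ≤ N) (hη : ∀ t, 0 ≤ η t) (hanti : Antitone η) {τ t : ℕ} (hH : t ≤ τ + H)
    (hx : ∀ i ω, x t i ω = x τ i ω + accumulated η g τ t i ω) :
    disagreement Pr x t
      ≤ 2 * disagreement Pr x τ + 2 * (N * D ^ 2 * H ^ 2 * η τ ^ 2) := by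
  have hV := integral_sum_accumulated_le h.memLp_g h.increment_le hη hanti hH
  -- The third term with coefficient 0 only fits the shape of `integral_le_linear_comb`.
  have hpt : ∀ ω, ∑ i, ‖x t i ω - avg fun j => x t j ω‖ ^ 2
      ≤ 2 * ∑ i, ‖x τ i ω - avg fun j => x τ j ω‖ ^ 2
        + 2 * ∑ i, ‖accumulated η g τ t i ω‖ ^ 2
        + 0 * ∑ i, ‖accumulated η g τ t i ω‖ ^ 2 := by
    intro ω
    have h1 := sum_norm_sub_avg_sq_le hN fun i => accumulated η g τ t i ω
    have h2 := sum_norm_add_sq_le_young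
      (u := fun i => x τ i ω - avg fun j => x τ j ω)
      (v := fun i => accumulated η g τ t i ω - avg fun j => accumulated η g τ t j ω)
      one_pos le_rfl h1
    have h3 : ∑ i, ‖x t i ω - avg fun j => x t j ω‖ ^ 2
        = ∑ i, ‖(x τ i ω - avg fun j => x τ j ω)
          + (accumulated η g τ t i ω - avg fun j => accumulated η g τ t j ω)‖ ^ 2 := by
      refine Finset.sum_congr rfl fun i _ => ?_
      simp_rw [hx]
      rw [avg_add]
      congr 2
      abel
    rw [h3]
    norm_num at h2 ⊢
    linarith
  have hVi := integrable_sum_norm_sq (memLp_accumulated h.memLp_g η τ t)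
  have := integral_le_linear_comb (integrable_sum_norm_sq (memLp_sub_avg (h.memLp_x t)))
    (integrable_sum_norm_sq (memLp_sub_avg (h.memLp_x τ))) hVi hVi hpt
  unfold disagreement
  linarith

theorem accumulated_succ {Ω : Type*} {x g : ℕ → Fin N → Ω → Vec n} {τ t : ℕ}
    (hτ : τ ≤ t) (hx : ∀ i ω, x t i ω = x τ i ω + accumulated η g τ t i ω) (i : Fin N) (ω : Ω) :
    x t i ω + η t • g t i ω = x τ i ω + accumulated η g τ (t + 1) i ω := by
  rw [hx, accumulated, accumulated, Finset.sum_Ico_succ_top hτ, add_assoc]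

/-! ### One communication period in expectation -/

section round

variable {G : Digraph (Fin N)} {φ : ℝ}

theorem IsMixingMatrix.disagreement_round (hW : IsMixingMatrix G W)
    (h : IsTrajectory Pr W γ p q D η I x y g) (hN : 1 ≤ N) (hγ : 0 < γ) (hκ : 0 < netKappa W)
    {τ t : ℕ} (hτ : τ ≤ t) (ht : t + 1 ∈ I) (hy : ∀ i ω, y t i ω = y τ i ω)
    (hx : ∀ i ω, x t i ω = x τ i ω + accumulated η g τ t i ω) :
    disagreement Pr x (t + 1)
      ≤ (1 + netKappa W * γ / 4) * (1 - 2 * γ * netKappa W + γ ^ 2 * netAlpha W ^ 2)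
          * disagreement Pr x τ
        + (1 + 4 / (netKappa W * γ)) * (2 * γ ^ 2 * netAlpha W ^ 2) * estimateError Pr x y τ
        + (1 + 4 / (netKappa W * γ)) * 2
          * ∫ ω, ∑ i, ‖accumulated η g τ (t + 1) i ω‖ ^ 2 ∂Pr := by
  refine integral_le_linear_comb (integrable_sum_norm_sq (memLp_sub_avg (h.memLp_x (t + 1))))
    (integrable_sum_norm_sq (memLp_sub_avg (h.memLp_x τ)))
    (integrable_sum_norm_sq fun i => (h.memLp_x τ i).sub (h.memLp_y τ i))
    (integrable_sum_norm_sq (memLp_accumulated h.memLp_g η τ (t + 1))) fun ω => ?_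
  have h1 := hW.consensus_round hN hγ hκ (x := fun i => x τ i ω) (y := fun i => y τ i ω)
    (v := fun i => accumulated η g τ (t + 1) i ω) (x' := fun i => x (t + 1) i ω) (fun i => by
      rw [h.step_comm t ht, accumulated_succ hτ hx]
      simp_rw [hy])
  exact h1.trans_eq (by ring)

theorem IsMixingMatrix.estimateError_round (hW : IsMixingMatrix G W)
    (h : IsTrajectory Pr W γ p q D η I x y g) (hγ : 0 < γ) (hφ : 0 < φ) (hp : p ≤ 1)
    {τ t : ℕ} (hτ : τ ≤ t) (ht : t + 1 ∈ I) (hy : ∀ i ω, y t i ω = y τ i ω)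
    (hx : ∀ i ω, x t i ω = x τ i ω + accumulated η g τ t i ω) :
    estimateError Pr x y (t + 1)
      ≤ (1 - p) * ((1 + φ / 4) * (1 + γ * netAlpha W) ^ 2 * estimateError Pr x y τ
        + (1 + 4 / φ) * (2 * γ ^ 2 * netAlpha W ^ 2) * disagreement Pr x τ
        + (1 + 4 / φ) * 2 * ∫ ω, ∑ i, ‖accumulated η g τ (t + 1) i ω‖ ^ 2 ∂Pr)
        + N * q * η t ^ 2 := by
  have hI : ∀ i, MemLp (fun ω => x (t + 1) i ω - y t i ω) 2 Pr := fun i =>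
    (h.memLp_x (t + 1) i).sub (h.memLp_y t i)
  have h1 : estimateError Pr x y (t + 1)
      ≤ (1 - p) * ∫ ω, ∑ i, ‖x (t + 1) i ω - y t i ω‖ ^ 2 ∂Pr + N * q * η t ^ 2 := by
    have hE : ∀ i, MemLp (fun ω => x (t + 1) i ω - y (t + 1) i ω) 2 Pr := fun i =>
      (h.memLp_x (t + 1) i).sub (h.memLp_y (t + 1) i)
    rw [estimateError, integral_finsetSum _ fun i _ => (hE i).integrable_norm_pow two_ne_zero,
      integral_finsetSum _ fun i _ => (hI i).integrable_norm_pow two_ne_zero]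
    refine (Finset.sum_le_sum fun i _ => h.estimate_comm t ht i).trans_eq ?_
    rw [Finset.sum_add_distrib, ← Finset.mul_sum, Finset.sum_const, Finset.card_univ,
      Fintype.card_fin, nsmul_eq_mul, mul_assoc (N : ℝ)]
  refine h1.trans (add_le_add_left (mul_le_mul_of_nonneg_left ?_ (sub_nonneg.2 hp)) _)
  refine integral_le_linear_comb (integrable_sum_norm_sq hI)
    (integrable_sum_norm_sq fun i => (h.memLp_x τ i).sub (h.memLp_y τ i))
    (integrable_sum_norm_sq (memLp_sub_avg (h.memLp_x τ)))
    (integrable_sum_norm_sq (memLp_accumulated h.memLp_g η τ (t + 1))) fun ω => ?_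
  have h2 := hW.estimate_round hγ hφ (x := fun i => x τ i ω) (y := fun i => y τ i ω)
    (v := fun i => accumulated η g τ (t + 1) i ω) (x' := fun i => x (t + 1) i ω) (fun i => by
      rw [h.step_comm t ht, accumulated_succ hτ hx]
      simp_rw [hy])
  simp_rw [hy]
  exact h2.trans_eq (by ring)

variable {a b r ψ δ : ℝ}

/-- The contraction of the Lyapunov function over one communication period. -/
theorem IsMixingMatrix.lyapunov_round (hW : IsMixingMatrix G W) (hN : 2 ≤ N)
    (h : IsTrajectory Pr W γ (ψ * r * φ) (ψ * r * δ ^ 2) D η I x y g)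
    (hadm : GammaAdmissible (netKappa W) (netAlpha W) φ ψ r γ) (hr : 0 < r) (hφ0 : 0 < φ)
    (hφ1 : φ ≤ 1) (hψ0 : 3 / (4 * r) < ψ) (hψ1 : ψ ≤ 1 / r) (hη : ∀ t, 0 ≤ η t)
    (hanti : Antitone η) {τ t : ℕ} (hτ : τ ≤ t) (ht : t + 1 ∈ I) (hH : t + 1 ≤ τ + H)
    (hy : ∀ i ω, y t i ω = y τ i ω)
    (hx : ∀ i ω, x t i ω = x τ i ω + accumulated η g τ t i ω) :
    disagreement Pr x (t + 1) + estimateError Pr x y (t + 1)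
      ≤ (1 - zetaOne (netKappa W) (netAlpha W) φ ψ r γ)
          * (disagreement Pr x τ + estimateError Pr x y τ)
        + (zetaTwo N (netKappa W) (netAlpha W) φ ψ r γ D * H ^ 2 + N * ψ * r * δ ^ 2)
          * η τ ^ 2 := by
  obtain ⟨hq0, hq1, hp0, hp1⟩ := scaled_gain_bounds hr hφ0 hψ0 hψ1
  have hκ : 0 < netKappa W := kappa_pos_of_admissible hadm hφ0 (hp1.trans hφ1)
  have hκ1 := netKappa_le_one W
  have hκα := netKappa_le_netAlpha hN W
  have hα := hκ.le.trans hκα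
  have hd := hW.disagreement_round h (by omega) hadm.1 hκ hτ ht hy hx
  have he := hW.estimateError_round h hadm.1 hφ0 (hp1.trans hφ1) hτ ht hy hx
  have hV := integral_sum_accumulated_le h.memLp_g h.increment_le hη hanti hH
  -- `c1`, `c2`, `c3` bound the total coefficients of the disagreement, the estimation error and the
  -- accumulated noise after adding `hd` and `he`.
  have c1 := consensus_coeff_le hadm hκ hα hφ1
  have c2 := estimate_coeff_le hadm hκ hα hφ0 hφ1 hp0
  have c3 := noise_coeff_le (N := N) (D := D) hadm hκ hκ1 hκα hφ0 hφ1 (by linarith)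
    (hp1.trans hφ1)
  have m1 := mul_le_mul_of_nonneg_right c1 (disagreement_nonneg Pr x τ)
  have m2 := mul_le_mul_of_nonneg_right c2 (estimateError_nonneg Pr x y τ)
  have hγ := hadm.1
  have hp : 0 ≤ 1 - ψ * r * φ := by linarith
  have m3 := mul_le_mul_of_nonneg_left hV (show 0 ≤ (1 + 4 / (netKappa W * γ)) * 2
    + (1 - ψ * r * φ) * ((1 + 4 / φ) * 2) by positivity)
  have m4 := mul_le_mul_of_nonneg_right c3 (show 0 ≤ (H : ℝ) ^ 2 * η τ ^ 2 by positivity)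
  have hητ : η t ^ 2 ≤ η τ ^ 2 := pow_le_pow_left₀ (hη t) (hanti hτ) 2
  have m5 := mul_le_mul_of_nonneg_left hητ
    (show 0 ≤ (N : ℝ) * (ψ * r * δ ^ 2) by positivity)
  refine (add_le_add hd he).trans ?_
  generalize ∫ ω, ∑ i, ‖accumulated η g τ (t + 1) i ω‖ ^ 2 ∂Pr = v at *
  linarith

/-- Between two communication times the trajectory is governed by the latest of them, where the
Lyapunov function is of the order of the squared step size. -/
theorem IsMixingMatrix.exists_last_round (hW : IsMixingMatrix G W) (hN : 2 ≤ N)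
    (h : IsTrajectory Pr W γ (ψ * r * φ) (ψ * r * δ ^ 2) D (stepSize a b) I x y g)
    (hI : IsSchedule I H)
    (hadm : GammaAdmissible (netKappa W) (netAlpha W) φ ψ r γ) (hr : 0 < r) (hφ0 : 0 < φ)
    (hφ1 : φ ≤ 1) (hψ0 : 3 / (4 * r) < ψ) (hψ1 : ψ ≤ 1 / r) (ha0 : 0 < a) (hb : 0 < b)
    (hD : 0 < D) (ha : 4 * H / (3 * zetaOne (netKappa W) (netAlpha W) φ ψ r γ) < a) (t : ℕ) :
    ∃ τ ≤ t, t < τ + H ∧ (∀ u ∈ I, u ≤ t → u ≤ τ) ∧ (∀ i ω, y t i ω = y τ i ω) ∧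
      (∀ i ω, x t i ω = x τ i ω + accumulated (stepSize a b) g τ t i ω) ∧
      zetaOne (netKappa W) (netAlpha W) φ ψ r γ * (disagreement Pr x τ + estimateError Pr x y τ)
        ≤ 4 * (zetaTwo N (netKappa W) (netAlpha W) φ ψ r γ D * H ^ 2 + N * ψ * r * δ ^ 2)
          * stepSize a b τ ^ 2 := by
  obtain ⟨hq0, hq1, hp0, hp1⟩ := scaled_gain_bounds hr hφ0 hψ0 hψ1
  have hκ : 0 < netKappa W := kappa_pos_of_admissible hadm hφ0 (hp1.trans hφ1)
  have hα : 0 ≤ netAlpha W := l2Norm_nonneg _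
  have hη := stepSize_pos ha0 hb
  have hanti := stepSize_antitone ha0 hb
  have hH1 : 1 ≤ H := by
    obtain ⟨u, hu, hu1, hu2⟩ := hI.gap 1 le_rfl
    omega
  set z := zetaOne (netKappa W) (netAlpha W) φ ψ r γ with hz
  have hz0 : 0 < z := zetaOne_pos hadm
  have hz1 : z ≤ 1 / 4 := zetaOne_le hadm hκ hα hφ1
  have hζ₂ := zetaTwo_pos (N := N) (by omega) hD hκ hα hadm.1 hφ0 (hp1.trans hφ1)
  set A := zetaTwo N (netKappa W) (netAlpha W) φ ψ r γ D * H ^ 2 + N * ψ * r * δ ^ 2 with hA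
  have hA0 : 0 ≤ A := by
    have : (N : ℝ) * ψ * r * δ ^ 2 = N * (ψ * r) * δ ^ 2 := by ring
    rw [hA, this]
    positivity
  induction t with
  | zero =>
    refine ⟨0, le_rfl, by omega, fun u _ hu => hu, fun i ω => rfl, fun i ω => ?_, ?_⟩
    · simp [accumulated]
    · have h1 : disagreement Pr x 0 = 0 := by simp [disagreement, h.x_zero, avg]
      have h2 : estimateError Pr x y 0 = 0 := by simp [estimateError, h.x_zero, h.y_zero]
      rw [h1, h2, add_zero, mul_zero]
      positivity
  | succ t ih =>
    obtain ⟨τ, hτ, hτH, hlast, hy, hx, hΦ⟩ := ih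
    by_cases ht : t + 1 ∈ I
    · refine ⟨t + 1, le_rfl, by omega, fun u _ hu => hu, fun i ω => rfl, fun i ω => ?_, ?_⟩
      · simp [accumulated]
      · have h1 := hW.lyapunov_round hN h hadm hr hφ0 hφ1 hψ0 hψ1 (fun t => (hη t).le) hanti hτ ht
          (by omega : t + 1 ≤ τ + H) hy hx
        rw [← hz, ← hA] at h1
        have h2 := mul_le_mul_of_nonneg_left h1 hz0.le
        have h3 := mul_le_mul_of_nonneg_left hΦ (show 0 ≤ 1 - z by linarith)
        -- The induction closes because `(1 - z) · 4A + zA = 4A (1 - 3z/4)`; the condition on `a`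
        -- says exactly that the squared step size loses at most the factor `1 - 3z/4` over a window
        -- of length `H`.
        have h4 : (1 - 3 * z / 4) * stepSize a b τ ^ 2 ≤ stepSize a b (t + 1) ^ 2 := by
          rw [stepSize_sq b ha0, stepSize_sq b ha0, mul_div_assoc', div_le_div_iff₀ (by positivity)
            (by positivity)]
          have e1 : ((t + 1 : ℕ) : ℝ) ≤ τ + H := by exact_mod_cast (by omega : t + 1 ≤ τ + H)
          have e2 : 4 * (H : ℝ) ≤ a * (3 * z) := by
            rw [div_lt_iff₀ (by positivity)] at ha
            exact ha.le
          have e3 : (1 - 3 * z / 4) * (((t + 1 : ℕ) : ℝ) + a) ≤ τ + a := by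
            have : (1 - 3 * z / 4) * (((t + 1 : ℕ) : ℝ) + a) ≤ (1 - 3 * z / 4) * (τ + H + a) :=
              mul_le_mul_of_nonneg_left (by linarith) (by linarith)
            have e4 : (0 : ℝ) ≤ z * τ := by positivity
            have e5 : (0 : ℝ) ≤ z * H := by positivity
            nlinarith
          have := mul_le_mul_of_nonneg_left e3 (sq_nonneg b)
          linarith
        have h5 := mul_le_mul_of_nonneg_left h4 hA0
        linarith
    · refine ⟨τ, by omega, ?_, fun u hu hu1 => ?_, fun i ω => ?_, fun i ω => ?_, hΦ⟩
      -- The schedule supplies a communication time less than `H` steps back; it is not `t + 1`, so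
      -- it is at most `τ`.
      · obtain ⟨u, hu, hu1, hu2⟩ := hI.gap (t + 1) (by omega)
        have : u ≠ t + 1 := fun e => ht (e ▸ hu)
        have := hlast u hu (by omega)
        omega
      · have : u ≠ t + 1 := fun e => ht (e ▸ hu)
        exact hlast u hu (by omega)
      · rw [h.estimate_local t ht, hy]
      · rw [h.step_local t ht, accumulated_succ hτ hx]

theorem disagreement_of_subsingleton (hN : N = 1) (t : ℕ) : disagreement Pr x t = 0 := by
  subst hN
  simp [disagreement, avg]

/-- The disagreement of the agents is of the order of the squared step size. -/
theorem IsMixingMatrix.disagreement_le (hW : IsMixingMatrix G W) (hN : 1 ≤ N)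
    (h : IsTrajectory Pr W γ (ψ * r * φ) (ψ * r * δ ^ 2) D (stepSize a b) I x y g)
    (hI : IsSchedule I H)
    (hadm : GammaAdmissible (netKappa W) (netAlpha W) φ ψ r γ) (hr : 0 < r) (hφ0 : 0 < φ)
    (hφ1 : φ ≤ 1) (hψ0 : 3 / (4 * r) < ψ) (hψ1 : ψ ≤ 1 / r) (ha0 : 0 < a) (hb : 0 < b)
    (hD : 0 < D) (ha : 4 * H / (3 * zetaOne (netKappa W) (netAlpha W) φ ψ r γ) < a) (t : ℕ) :
    disagreement Pr x t
      ≤ consensusConst N H (netKappa W) (netAlpha W) φ ψ r γ δ D * stepSize a b t ^ 2 := by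
  obtain ⟨hq0, hq1, hp0, hp1⟩ := scaled_gain_bounds hr hφ0 hψ0 hψ1
  have hκ : 0 < netKappa W := kappa_pos_of_admissible hadm hφ0 (hp1.trans hφ1)
  have hα : 0 ≤ netAlpha W := l2Norm_nonneg _
  have hH1 : 1 ≤ H := by
    obtain ⟨u, hu, hu1, hu2⟩ := hI.gap 1 le_rfl
    omega
  have hζ₂ := zetaTwo_pos hN hD hκ hα hadm.1 hφ0 (hp1.trans hφ1)
  have hC := le_consensusConst (δ := δ) hN hH1 hζ₂.le (show 0 ≤ ψ * r by linarith)
  rcases hN.eq_or_lt with hN1 | hN2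
  -- For a single agent `κ ≤ α` may fail, but there is nothing to agree on.
  · rw [disagreement_of_subsingleton hN1.symm]
    have : 0 < 8 * D ^ 2 := by positivity
    exact mul_nonneg (by linarith) (sq_nonneg _)
  obtain ⟨τ, hτ, hτH, -, -, hx, hΦ⟩ := hW.exists_last_round hN2 h hI hadm hr hφ0 hφ1 hψ0 hψ1 ha0
    hb hD ha t
  have h1 := disagreement_le_of_accumulated h hN (fun t => (stepSize_pos ha0 hb t).le)
    (stepSize_antitone ha0 hb) hτH.le hx
  have he := estimateError_nonneg Pr x y τ
  have hz0 : 0 < zetaOne (netKappa W) (netAlpha W) φ ψ r γ := zetaOne_pos hadm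
  have hz1 : zetaOne (netKappa W) (netAlpha W) φ ψ r γ ≤ 1 / 4 := zetaOne_le hadm hκ hα hφ1
  unfold consensusConst
  generalize zetaOne (netKappa W) (netAlpha W) φ ψ r γ = z at *
  have hA : 0 ≤ zetaTwo N (netKappa W) (netAlpha W) φ ψ r γ D * H ^ 2 + N * ψ * r * δ ^ 2 := by
    have : (N : ℝ) * ψ * r * δ ^ 2 = N * (ψ * r) * δ ^ 2 := by ring
    rw [this]
    positivity
  have h16 : 16 * zetaTwo N (netKappa W) (netAlpha W) φ ψ r γ D * (H : ℝ) ^ 2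
      + 16 * N * ψ * r * δ ^ 2
      = 16 * (zetaTwo N (netKappa W) (netAlpha W) φ ψ r γ D * H ^ 2 + N * ψ * r * δ ^ 2) := by
    ring
  rw [h16]
  generalize zetaTwo N (netKappa W) (netAlpha W) φ ψ r γ D * (H : ℝ) ^ 2 + N * ψ * r * δ ^ 2 = A
    at *
  -- Since `z ≤ 1/4`, the condition on `a` gives `H ≤ a`. This factor 2, the 2 from splitting off
  -- the partial window and the 4 from `hΦ` make up the 16 in `C₁`.
  have h2 : stepSize a b τ ^ 2 ≤ 2 * stepSize a b t ^ 2 := by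
    rw [stepSize_sq b ha0, stepSize_sq b ha0, mul_div_assoc', div_le_div_iff₀ (by positivity)
      (by positivity)]
    have e1 : (t : ℝ) ≤ τ + H := by exact_mod_cast hτH.le
    have e2 : 4 * (H : ℝ) ≤ a * (3 * z) := by
      rw [div_lt_iff₀ (by positivity)] at ha
      exact ha.le
    have e3 : (H : ℝ) ≤ a := by nlinarith
    have e4 : (0 : ℝ) ≤ τ := by positivity
    have := mul_le_mul_of_nonneg_left (show (t : ℝ) + a ≤ 2 * (τ + a) by linarith) (sq_nonneg b)
    linarith
  have h3 : disagreement Pr x τ ≤ 4 * (A / z ^ 2) * stepSize a b τ ^ 2 := by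
    have e1 : z * disagreement Pr x τ ≤ 4 * A * stepSize a b τ ^ 2 := by nlinarith
    have e2 : 4 * (A / z ^ 2) * stepSize a b τ ^ 2 = (4 * A * stepSize a b τ ^ 2) / z ^ 2 := by
      ring
    rw [e2, le_div_iff₀ (by positivity)]
    have e3 : 0 ≤ z * disagreement Pr x τ := mul_nonneg hz0.le (disagreement_nonneg Pr x τ)
    have := mul_le_mul_of_nonneg_right (show z ≤ 1 by linarith) e3
    linarith
  have hAz : 0 ≤ A / z ^ 2 := by positivity
  have hB : 0 ≤ (N : ℝ) * D ^ 2 * H ^ 2 := by positivity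
  have m1 := mul_le_mul_of_nonneg_left h2 hAz
  have m2 := mul_le_mul_of_nonneg_left h2 hB
  have hs := mul_nonneg hB (sq_nonneg (stepSize a b t))
  rw [mul_div_assoc]
  linarith

end round

end consensus

/-! ### The surrogate function -/

section surrogate

variable {n : ℕ} {F : Vec n → Vec n} {Φ : Vec n → ℝ} {L : ℝ}

/-- A potential of `x ↦ x - F x`, given a potential `Φ` of `F`. -/
def residualPotential (Φ : Vec n → ℝ) (x : Vec n) : ℝ := ‖x‖ ^ 2 / 2 - Φ x

theorem hasDerivAt_residualPotential (hΦ : ∀ x, HasGradientAt Φ (F x) x) (x v : Vec n) (u : ℝ) :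
    HasDerivAt (fun u : ℝ => residualPotential Φ (x + u • v))
      ⟪(x + u • v) - F (x + u • v), v⟫_ℝ u := by
  have hp : HasDerivAt (fun u : ℝ => x + u • v) v u := by
    simpa using ((hasDerivAt_id u).smul_const v).const_add x
  have h1 := (hp.norm_sq).div_const 2
  have h2 := (hΦ (x + u • v)).hasFDerivAt.comp_hasDerivAt u hp
  refine (h1.sub h2).congr_deriv ?_
  rw [InnerProductSpace.toDual_apply_apply, inner_sub_left]
  ring

theorem continuous_residualPotential (hΦ : ∀ x, HasGradientAt Φ (F x) x) :
    Continuous (residualPotential Φ) :=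
  ((continuous_norm.pow 2).div_const 2).sub
    (continuous_iff_continuousAt.2 fun x => (hΦ x).continuousAt)

theorem continuous_of_dist_le (hF : ∀ x y, ‖F x - F y‖ ≤ L * ‖x - y‖) : Continuous F := by
  refine (LipschitzWith.of_dist_le_mul (K := L.toNNReal) fun x y => ?_).continuous
  rw [dist_eq_norm, dist_eq_norm]
  refine (hF x y).trans ?_
  gcongr
  exact Real.le_coe_toNNReal L

/-- The fundamental theorem of calculus along the ray from 0. A lower bound on the surrogate thus
limits the total decrease of the potential from the starting point 0. -/
theorem surrogate_eq_sub (hΦ : ∀ x, HasGradientAt Φ (F x) x) (hF : Continuous F) (y : Vec n) :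
    surrogate F 0 y = residualPotential Φ y - residualPotential Φ 0 := by
  have h := intervalIntegral.integral_eq_sub_of_hasDerivAt (a := 0) (b := 1)
    (fun u _ => hasDerivAt_residualPotential hΦ 0 y u)
    (Continuous.intervalIntegrable (by fun_prop) 0 1)
  simpa [surrogate] using h

theorem residual_lipschitz (hF : ∀ x y, ‖F x - F y‖ ≤ L * ‖x - y‖) (x y : Vec n) :
    ‖(x - F x) - (y - F y)‖ ≤ (1 + L) * ‖x - y‖ := by
  have h : (x - F x) - (y - F y) = (x - y) - (F x - F y) := by abel
  rw [h]
  refine (norm_sub_le _ _).trans ?_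
  linarith [hF x y]

/-- The descent lemma. -/
theorem abs_residualPotential_sub_le (hL : 0 ≤ L) (hΦ : ∀ x, HasGradientAt Φ (F x) x)
    (hF : ∀ x y, ‖F x - F y‖ ≤ L * ‖x - y‖) (x v : Vec n) :
    |residualPotential Φ (x + v) - residualPotential Φ x - ⟪x - F x, v⟫_ℝ|
      ≤ (1 + L) * ‖v‖ ^ 2 := by
  have hd := hasDerivAt_residualPotential hΦ x v
  -- The mean value theorem suffices; it yields the constant `1 + L` instead of the sharp `(1 +
  -- L)/2`.
  obtain ⟨u, ⟨hu0, hu1⟩, hu⟩ := exists_hasDerivAt_eq_slope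
    (fun u : ℝ => residualPotential Φ (x + u • v)) _ one_pos
    (fun u _ => (hd u).continuousAt.continuousWithinAt) (fun u _ => hd u)
  simp only [one_smul, zero_smul, add_zero, sub_zero, div_one] at hu
  rw [← hu, ← inner_sub_left]
  refine (abs_real_inner_le_norm _ _).trans ?_
  have h1 := residual_lipschitz hF (x + u • v) x
  rw [add_sub_cancel_left, norm_smul, Real.norm_of_nonneg hu0.le] at h1
  have h2 : (1 + L) * (u * ‖v‖) ≤ (1 + L) * (1 * ‖v‖) := by gcongr
  calc _ ≤ (1 + L) * (1 * ‖v‖) * ‖v‖ := by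
        gcongr
        exact h1.trans h2
    _ = _ := by ring

/-- The descent lemma at base point 0 shows that the potential grows at most quadratically. -/
theorem integrable_residualPotential_comp {Ω : Type*} [MeasurableSpace Ω] {Pr : Measure Ω}
    [IsProbabilityMeasure Pr] (hL : 0 ≤ L) (hΦ : ∀ x, HasGradientAt Φ (F x) x)
    (hF : ∀ x y, ‖F x - F y‖ ≤ L * ‖x - y‖) {X : Ω → Vec n} (hX : MemLp X 2 Pr) :
    Integrable (fun ω => residualPotential Φ (X ω)) Pr := by
  have h2 : Integrable (fun ω => ‖X ω‖ ^ 2) Pr := hX.integrable_norm_pow two_ne_zero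
  have h1 : Integrable (fun ω => ⟪(0 : Vec n) - F 0, X ω⟫_ℝ) Pr :=
    (hX.integrable one_le_two).const_inner _
  have h3 : Integrable (fun ω => residualPotential Φ (X ω) - residualPotential Φ 0
      - ⟪(0 : Vec n) - F 0, X ω⟫_ℝ) Pr := by
    refine (h2.const_mul (1 + L)).mono' ?_ (.of_forall fun ω => ?_)
    · exact (((continuous_residualPotential hΦ).comp_aestronglyMeasurable hX.1).sub
        aestronglyMeasurable_const).sub h1.1
    · have := abs_residualPotential_sub_le hL hΦ hF 0 (X ω)
      rwa [zero_add] at this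
  refine ((h3.add h1).add (integrable_const (residualPotential Φ 0))).congr (.of_forall fun ω => ?_)
  simp only [Pi.add_apply]
  ring

end surrogate

/-! ### The global operator -/

section globalOp

variable {N n : ℕ} {F : Fin N → Vec n → Vec n} {L : ℝ}

theorem hasGradientAt_globalOp {Φ : Fin N → Vec n → ℝ}
    (hΦ : ∀ i x, HasGradientAt (Φ i) (F i x) x) (x : Vec n) :
    HasGradientAt (fun x => (1 / N : ℝ) * ∑ i, Φ i x) (globalOp F x) x := by
  rw [hasGradientAt_iff_hasFDerivAt]
  have h := (HasFDerivAt.fun_sum fun i (_ : i ∈ Finset.univ) =>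
    (hΦ i x).hasFDerivAt).const_mul (1 / N : ℝ)
  refine h.congr_fderiv ?_
  rw [globalOp, avg, map_smul, map_sum]

theorem globalOp_lipschitz (hN : 1 ≤ N) (hF : ∀ i x y, ‖F i x - F i y‖ ≤ L * ‖x - y‖)
    (x y : Vec n) : ‖globalOp F x - globalOp F y‖ ≤ L * ‖x - y‖ := by
  have hN' : (0 : ℝ) < N := by positivity
  rw [globalOp, globalOp, ← avg_sub, avg, norm_smul, Real.norm_of_nonneg (by positivity)]
  calc (1 / N : ℝ) * ‖∑ i, (F i x - F i y)‖ ≤ (1 / N : ℝ) * ∑ _i : Fin N, L * ‖x - y‖ := by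
        gcongr
        exact norm_sum_le_of_le _ fun i _ => hF i x y
    _ = L * ‖x - y‖ := by
        rw [Finset.sum_const, Finset.card_univ, Fintype.card_fin, nsmul_eq_mul]
        field_simp

theorem sum_residual_sub_sq_le (hF : ∀ i x y, ‖F i x - F i y‖ ≤ L * ‖x - y‖)
    (X : Fin N → Vec n) (c : Vec n) :
    (1 / N : ℝ) * ∑ i, ‖(F i (X i) - X i) - (F i c - c)‖ ^ 2
      ≤ (1 + L) ^ 2 * ((1 / N : ℝ) * ∑ i, ‖X i - c‖ ^ 2) := by
  rw [mul_left_comm, Finset.mul_sum _ _ ((1 + L) ^ 2)]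
  refine mul_le_mul_of_nonneg_left (Finset.sum_le_sum fun i _ => ?_) (by positivity)
  rw [← mul_pow]
  refine pow_le_pow_left₀ (norm_nonneg _) (le_of_eq_of_le ?_ (residual_lipschitz (hF i) (X i) c)) 2
  rw [← norm_neg]
  congr 1
  abel

theorem sum_residual_sq_le (hN : 1 ≤ N) {ζ : ℝ} (hζ : BoundedHeterogeneity F ζ) (c : Vec n) :
    (1 / N : ℝ) * ∑ i, ‖F i c - c‖ ^ 2 ≤ ‖c - globalOp F c‖ ^ 2 + ζ ^ 2 := by
  have h : (avg fun i => F i c - c) = globalOp F c - c := by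
    rw [avg_sub (fun i => F i c) fun _ => c, avg_const hN, globalOp]
  rw [sum_norm_sq_eq_add_sum_sub_avg hN, h, norm_sub_rev c]
  refine add_le_add le_rfl (le_of_eq_of_le ?_ (hζ c))
  simp_rw [sub_sub_sub_cancel_right]

/-- Heterogeneity is controlled only at a common argument, so the local points are first moved to
`c` at the price of the disagreement. -/
theorem sum_local_residual_sq_le (hN : 1 ≤ N) {ζ ε : ℝ} (hε : 0 < ε)
    (hF : ∀ i x y, ‖F i x - F i y‖ ≤ L * ‖x - y‖) (hζ : BoundedHeterogeneity F ζ)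
    (X : Fin N → Vec n) (c : Vec n) :
    (1 / N : ℝ) * ∑ i, ‖F i (X i) - X i‖ ^ 2
      ≤ (1 + ε) * (‖c - globalOp F c‖ ^ 2 + ζ ^ 2)
        + (1 + 1 / ε) * ((1 + L) ^ 2 * ((1 / N : ℝ) * ∑ i, ‖X i - c‖ ^ 2)) := by
  calc (1 / N : ℝ) * ∑ i, ‖F i (X i) - X i‖ ^ 2
      ≤ (1 / N : ℝ) * ∑ i, ((1 + ε) * ‖F i c - c‖ ^ 2
          + (1 + 1 / ε) * ‖(F i (X i) - X i) - (F i c - c)‖ ^ 2) := by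
        refine mul_le_mul_of_nonneg_left (Finset.sum_le_sum fun i _ => ?_) (by positivity)
        have := norm_add_sq_le_young (F i c - c) ((F i (X i) - X i) - (F i c - c)) hε
        rwa [add_sub_cancel] at this
    _ = (1 + ε) * ((1 / N : ℝ) * ∑ i, ‖F i c - c‖ ^ 2)
        + (1 + 1 / ε) * ((1 / N : ℝ) * ∑ i, ‖(F i (X i) - X i) - (F i c - c)‖ ^ 2) := by
        rw [Finset.sum_add_distrib, ← Finset.mul_sum, ← Finset.mul_sum]
        ring
    _ ≤ _ := add_le_add (mul_le_mul_of_nonneg_left (sum_residual_sq_le hN hζ c) (by positivity))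
        (mul_le_mul_of_nonneg_left (sum_residual_sub_sq_le hF X c) (by positivity))

theorem norm_avg_bias_sq_le (hN : 1 ≤ N) {P β : ℝ} (X h : Fin N → Vec n)
    (hh : ∀ i, ‖h i - (F i (X i) - X i)‖ ^ 2 ≤ β ^ 2 + P * ‖F i (X i) - X i‖ ^ 2) :
    ‖avg fun i => h i - (F i (X i) - X i)‖ ^ 2
      ≤ β ^ 2 + P * ((1 / N : ℝ) * ∑ i, ‖F i (X i) - X i‖ ^ 2) := by
  have hN' : (0 : ℝ) < N := by positivity
  calc _ ≤ (1 / N : ℝ) * ∑ i, ‖h i - (F i (X i) - X i)‖ ^ 2 := norm_avg_sq_le hN _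
    _ ≤ (1 / N : ℝ) * ∑ i, (β ^ 2 + P * ‖F i (X i) - X i‖ ^ 2) :=
        mul_le_mul_of_nonneg_left (Finset.sum_le_sum fun i _ => hh i) (by positivity)
    _ = _ := by
        rw [Finset.sum_add_distrib, ← Finset.mul_sum, Finset.sum_const, Finset.card_univ,
          Fintype.card_fin, nsmul_eq_mul]
        field_simp

theorem inner_le_weighted {E : Type*} [NormedAddCommGroup E] [InnerProductSpace ℝ E] (u v : E)
    {ε : ℝ} (hε : 0 < ε) : ⟪u, v⟫_ℝ ≤ ε / 2 * ‖u‖ ^ 2 + 1 / (2 * ε) * ‖v‖ ^ 2 := by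
  refine (real_inner_le_norm _ _).trans ?_
  have h0 : 0 ≤ (ε * ‖u‖ - ‖v‖) ^ 2 * (1 / (2 * ε)) := by positivity
  have h1 : (ε * ‖u‖ - ‖v‖) ^ 2 * (1 / (2 * ε))
      = ε / 2 * ‖u‖ ^ 2 - ‖u‖ * ‖v‖ + 1 / (2 * ε) * ‖v‖ ^ 2 := by
    field_simp
    ring
  linarith

/-- The expected increments form a descent direction, up to the bias and the disagreement. -/
theorem inner_avg_increment_le (hN : 1 ≤ N) {P ζ β : ℝ} (hP0 : 0 ≤ P) (hP1 : P < 1)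
    (hF : ∀ i x y, ‖F i x - F i y‖ ≤ L * ‖x - y‖) (hζ : BoundedHeterogeneity F ζ)
    (X h : Fin N → Vec n) (c : Vec n)
    (hh : ∀ i, ‖h i - (F i (X i) - X i)‖ ^ 2 ≤ β ^ 2 + P * ‖F i (X i) - X i‖ ^ 2) :
    ⟪c - globalOp F c, avg h⟫_ℝ
      ≤ -((1 - P) / 8 * ‖c - globalOp F c‖ ^ 2) + (β ^ 2 + 2 * P * ζ ^ 2) / 2
        + (1 + L) ^ 2 * (4 / (1 - P)) * ((1 / N : ℝ) * ∑ i, ‖X i - c‖ ^ 2) := by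
  have hP2 : 0 < 1 - P := by linarith
  have hdecomp : avg h = -(c - globalOp F c) + (avg fun i => (F i (X i) - X i) - (F i c - c))
      + avg fun i => h i - (F i (X i) - X i) := by
    have h1 : -(c - globalOp F c) = avg fun i => F i c - c := by
      rw [avg_sub (fun i => F i c) fun _ => c, avg_const hN, globalOp, neg_sub]
    rw [h1, ← avg_add, ← avg_add]
    congr 1
    ext1 i
    abel
  -- The weights are tuned so that the coefficient of `‖c - 𝒯 c‖²` is `-1 + (1 - P)/8 + 1/2 + (1 +
  -- P)/4 = -(1 - P)/8`. The last summand uses `P (1 + (1 - P)/2) ≤ (1 + P)/2`, which is `(1 - P)² ≥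
  -- 0`.
  have hw := sum_local_residual_sq_le (ε := (1 - P) / 2) hN (by positivity) hF hζ X c
  have hb := norm_avg_bias_sq_le hN X h hh
  have ha := (norm_avg_sq_le hN fun i => (F i (X i) - X i) - (F i c - c)).trans
    (sum_residual_sub_sq_le hF X c)
  have i1 := inner_le_weighted (c - globalOp F c)
    (avg fun i => (F i (X i) - X i) - (F i c - c)) (ε := (1 - P) / 4) (by positivity)
  have i2 := inner_le_weighted (c - globalOp F c)
    (avg fun i => h i - (F i (X i) - X i)) one_pos
  rw [hdecomp, inner_add_right, inner_add_right, inner_neg_right, real_inner_self_eq_norm_sq]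
  have hR : 0 ≤ (1 + L) ^ 2 * ((1 / N : ℝ) * ∑ i, ‖X i - c‖ ^ 2) := by positivity
  have hR' : (1 + L) ^ 2 * (4 / (1 - P)) * ((1 / N : ℝ) * ∑ i, ‖X i - c‖ ^ 2)
      = 4 * (1 / (1 - P)) * ((1 + L) ^ 2 * ((1 / N : ℝ) * ∑ i, ‖X i - c‖ ^ 2)) := by ring
  rw [hR']
  generalize (1 + L) ^ 2 * ((1 / N : ℝ) * ∑ i, ‖X i - c‖ ^ 2) = R at *
  generalize (1 / N : ℝ) * ∑ i, ‖F i (X i) - X i‖ ^ 2 = w at *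
  generalize ‖avg fun i => h i - (F i (X i) - X i)‖ ^ 2 = B at *
  generalize ‖avg fun i => (F i (X i) - X i) - (F i c - c)‖ ^ 2 = A at *
  have hg : 0 ≤ ‖c - globalOp F c‖ ^ 2 := sq_nonneg _
  generalize ‖c - globalOp F c‖ ^ 2 = g at *
  have e1 : 1 / (2 * ((1 - P) / 4)) = 2 * (1 / (1 - P)) := by field_simp; norm_num
  have e2 : 1 / ((1 - P) / 2) = 2 * (1 / (1 - P)) := by field_simp
  have k8 : 1 ≤ 1 / (1 - P) := by rw [le_div_iff₀ hP2]; linarith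
  rw [e1] at i1
  rw [e2] at hw
  generalize 1 / (1 - P) = ρ at *
  have k1 := mul_le_mul_of_nonneg_left ha (show 0 ≤ 2 * ρ by linarith)
  have k2 := mul_le_mul_of_nonneg_left hw hP0
  have k3 : P * (1 + (1 - P) / 2) ≤ (1 + P) / 2 := by nlinarith
  have k4 := mul_le_mul_of_nonneg_right k3 hg
  have k5 : P * (1 + (1 - P) / 2) ≤ 2 * P := by nlinarith
  have k6 := mul_le_mul_of_nonneg_right k5 (sq_nonneg ζ)
  have k9 : P * (1 + 2 * ρ) ≤ 3 * ρ := by nlinarith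
  have k10 := mul_le_mul_of_nonneg_right k9 hR
  have k11 : 0 ≤ ρ * R := mul_nonneg (by linarith) hR
  linarith

end globalOp

/-! ### Telescoping with the step size `b / √(t + a)` -/

section rate

variable {a b : ℝ}

theorem sqrt_add_le_sqrt_mul (ha : 0 < a) {T : ℕ} (hT : 1 ≤ T) :
    √((T : ℝ) + a) ≤ √T * √(1 + a) := by
  rw [← Real.sqrt_mul (by positivity)]
  refine Real.sqrt_le_sqrt ?_
  have : (1 : ℝ) ≤ T := by exact_mod_cast hT
  nlinarith

/-- The factor that compares `1 / a + log (1 + T / a)` with `log T`. -/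
def logFactor (a : ℝ) : ℝ := 1 + (1 / a + Real.log (1 + 1 / a)) / Real.log 2

theorem logFactor_pos (ha : 0 < a) : 0 < logFactor a := by
  have h1 : 0 < Real.log 2 := Real.log_pos one_lt_two
  have h2 : 0 ≤ Real.log (1 + 1 / a) := Real.log_nonneg (by simp; positivity)
  unfold logFactor
  positivity

theorem log_one_add_div_le (ha : 0 < a) {T : ℕ} (hT : 2 ≤ T) :
    1 / a + Real.log (1 + T / a) ≤ logFactor a * Real.log T := by
  have hT' : (2 : ℝ) ≤ T := by exact_mod_cast hT
  have h1 : 0 < Real.log 2 := Real.log_pos one_lt_two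
  have h2 : 0 ≤ Real.log (1 + 1 / a) := Real.log_nonneg (by simp; positivity)
  have h3 : Real.log 2 ≤ Real.log T := Real.log_le_log two_pos hT'
  have h4 : Real.log (1 + T / a) ≤ Real.log T + Real.log (1 + 1 / a) := by
    rw [← Real.log_mul (by positivity) (by positivity)]
    refine Real.log_le_log (by positivity) ?_
    have : (T : ℝ) * (1 + 1 / a) = T + T / a := by ring
    linarith
  have h5 : 1 / a + Real.log (1 + 1 / a)
      ≤ (1 / a + Real.log (1 + 1 / a)) / Real.log 2 * Real.log T := by
    rw [div_mul_eq_mul_div, le_div_iff₀ h1]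
    gcongr
  unfold logFactor
  linarith

theorem sum_stepSize_sq_Icc_le (ha : 0 < a) (T : ℕ) :
    ∑ t ∈ Finset.Icc 1 T, stepSize a b t ^ 2 ≤ b ^ 2 * Real.log (1 + T / a) := by
  calc ∑ t ∈ Finset.Icc 1 T, stepSize a b t ^ 2
      = b ^ 2 * ∑ t ∈ Finset.Icc 1 T, 1 / ((t : ℝ) + a) := by
        rw [Finset.mul_sum]
        refine Finset.sum_congr rfl fun t _ => ?_
        rw [stepSize_sq b ha, mul_one_div]
    _ ≤ _ := by
        gcongr
        exact sum_inv_add_le_log ha T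

theorem sum_range_succ_eq_add_Icc (f : ℕ → ℝ) (T : ℕ) :
    ∑ t ∈ Finset.range (T + 1), f t = f 0 + ∑ t ∈ Finset.Icc 1 T, f t := by
  rw [Finset.sum_range_succ', Finset.range_eq_Ico, Finset.sum_Ico_add' f 0 T 1, add_comm]
  rfl

theorem sum_stepSize_sq_range_le (ha : 0 < a) (T : ℕ) :
    ∑ t ∈ Finset.range (T + 1), stepSize a b t ^ 2
      ≤ b ^ 2 * (1 / a + Real.log (1 + T / a)) := by
  rw [sum_range_succ_eq_add_Icc, mul_add]
  refine add_le_add ?_ (sum_stepSize_sq_Icc_le ha T)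
  rw [stepSize_sq b ha]
  simp [div_eq_mul_inv]

theorem sum_stepSize_le (ha : 0 < a) (hb : 0 < b) (T : ℕ) :
    ∑ t ∈ Finset.range (T + 1), stepSize a b t ≤ b * (1 / √a + 2 * √(T + a)) := by
  calc ∑ t ∈ Finset.range (T + 1), stepSize a b t
      = b * ∑ t ∈ Finset.range (T + 1), 1 / √((t : ℝ) + a) := by
        rw [Finset.mul_sum]
        refine Finset.sum_congr rfl fun t _ => ?_
        rw [stepSize, mul_one_div]
    _ ≤ _ := by
        gcongr
        exact sum_inv_sqrt_add_le ha T

/-- Since `q t` is of order `η_t²`, the consensus term is of third order in the step size and joins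
the quadratic noise term at the cost of a factor `η 0`. -/
theorem weighted_sum_le_of_descent {f d q η : ℕ → ℝ} {c c' B C K Δ : ℝ} (hη : ∀ t, 0 ≤ η t)
    (hanti : Antitone η) (hc' : 0 ≤ c') (hC : 0 ≤ C)
    (hstep : ∀ t, f (t + 1) ≤ f t - η t * (c * d t) + η t * B + η t * (c' * q t) + K * η t ^ 2)
    (hq : ∀ t, q t ≤ C * η t ^ 2) (hlow : ∀ t, f 0 - f t ≤ Δ) (T : ℕ) :
    ∑ t ∈ Finset.range T, η t * (c * d t)
      ≤ Δ + B * ∑ t ∈ Finset.range T, η t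
        + (c' * C * η 0 + K) * ∑ t ∈ Finset.range T, η t ^ 2 := by
  have h : ∀ t, η t * (c * d t)
      ≤ (f t - f (t + 1)) + B * η t + (c' * C * η 0 + K) * η t ^ 2 := by
    intro t
    have h1 : η t * (c' * q t) ≤ η 0 * (c' * (C * η t ^ 2)) :=
      (mul_le_mul_of_nonneg_left (mul_le_mul_of_nonneg_left (hq t) hc') (hη t)).trans
        (mul_le_mul_of_nonneg_right (hanti (Nat.zero_le t)) (by positivity))
    have := hstep t
    linarith
  refine (Finset.sum_le_sum fun t _ => h t).trans ?_
  rw [Finset.sum_add_distrib, Finset.sum_add_distrib, Finset.sum_range_sub', ← Finset.mul_sum,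
    ← Finset.mul_sum]
  linarith [hlow T]

/-- The convergence rate of a descent recursion with step size `b / √(t + a)`. -/
theorem average_le_of_descent (ha : 0 < a) (hb : 0 < b) {f d q : ℕ → ℝ} {c c' B C K Δ m : ℝ}
    (hc : 0 < c) (hc' : 0 ≤ c') (hB : 0 ≤ B) (hm : 0 < m) (hmC : m ≤ C) (hK : 0 ≤ K)
    (hd : ∀ t, 0 ≤ d t)
    (hstep : ∀ t, f (t + 1) ≤ f t - stepSize a b t * (c * d t) + stepSize a b t * B
      + stepSize a b t * (c' * q t) + K * stepSize a b t ^ 2)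
    (hq : ∀ t, q t ≤ C * stepSize a b t ^ 2) (hlow : ∀ t, f 0 - f t ≤ Δ) {T : ℕ} (hT : 2 ≤ T) :
    (1 / T : ℝ) * ∑ t ∈ Finset.Icc 1 T, d t
      ≤ √(1 + a) / (c * b) * (|Δ| / (m * Real.log 2)
          + (c' * (b / √a) + K / m) * (b ^ 2 * logFactor a)) * (C * Real.log T / √T)
        + √(1 + a) / c * (1 / √a + 2 * √(1 + a)) * B := by
  have hη := stepSize_pos ha hb
  have hanti := stepSize_antitone ha hb
  have hC : 0 < C := hm.trans_le hmC
  have hT' : (2 : ℝ) ≤ T := by exact_mod_cast hT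
  have hT0 : (0 : ℝ) < T := by linarith
  have hl2 : 0 < Real.log 2 := Real.log_pos one_lt_two
  have hlT : Real.log 2 ≤ Real.log T := Real.log_le_log two_pos hT'
  have hlf := logFactor_pos ha
  have hsT : 1 ≤ √(T : ℝ) := Real.one_le_sqrt.2 (by linarith)
  have hss : √(T : ℝ) * √(T : ℝ) = T := Real.mul_self_sqrt hT0.le
  have hs := sqrt_add_le_sqrt_mul ha (show 1 ≤ T by omega)
  have hsa : 0 < √a := Real.sqrt_pos.2 ha
  have hsTa : 0 < √((T : ℝ) + a) := Real.sqrt_pos.2 (by positivity)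
  have h1 := weighted_sum_le_of_descent (fun t => (hη t).le) hanti hc' hC.le hstep hq hlow (T + 1)
  have h0 : stepSize a b 0 = b / √a := by simp [stepSize]
  have hcoef : 0 ≤ c' * C * stepSize a b 0 + K := by
    have := (hη 0).le
    positivity
  -- Every weight up to `T` is at least the last one. The telescoped sum starts at 0, and its
  -- nonnegative initial term is dropped.
  have h2 : stepSize a b T * (c * ∑ t ∈ Finset.Icc 1 T, d t)
      ≤ ∑ t ∈ Finset.range (T + 1), stepSize a b t * (c * d t) := by
    rw [sum_range_succ_eq_add_Icc, Finset.mul_sum, Finset.mul_sum]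
    have : 0 ≤ stepSize a b 0 * (c * d 0) :=
      mul_nonneg (hη 0).le (mul_nonneg hc.le (hd 0))
    have : ∑ t ∈ Finset.Icc 1 T, stepSize a b T * (c * d t)
        ≤ ∑ t ∈ Finset.Icc 1 T, stepSize a b t * (c * d t) := by
      refine Finset.sum_le_sum fun t ht => ?_
      exact mul_le_mul_of_nonneg_right (hanti (Finset.mem_Icc.1 ht).2)
        (mul_nonneg hc.le (hd t))
    linarith
  have h3 := mul_le_mul_of_nonneg_left (sum_stepSize_le ha hb T) hB
  have h4 := mul_le_mul_of_nonneg_left ((sum_stepSize_sq_range_le (b := b) ha T).trans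
    (mul_le_mul_of_nonneg_left (log_one_add_div_le ha hT) (sq_nonneg b))) hcoef
  -- Constants are absorbed using `m ≤ C` and `log 2 ≤ log T`, which is where `T ≥ 2` is needed.
  have h5 : Δ ≤ |Δ| / (m * Real.log 2) * (C * Real.log T) := by
    refine (le_abs_self Δ).trans ?_
    rw [div_mul_eq_mul_div, le_div_iff₀ (by positivity)]
    gcongr
  have h6 : c' * C * stepSize a b 0 + K ≤ (c' * (b / √a) + K / m) * C := by
    have : K ≤ K / m * C := by
      rw [div_mul_eq_mul_div, le_div_iff₀ hm]
      gcongr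
    rw [h0]
    linarith
  have h7 : stepSize a b T * (c * ∑ t ∈ Finset.Icc 1 T, d t)
      ≤ (|Δ| / (m * Real.log 2) + (c' * (b / √a) + K / m) * (b ^ 2 * logFactor a))
          * (C * Real.log T)
        + B * (b * (1 / √a + 2 * √(T + a))) := by
    have h8 := mul_le_mul_of_nonneg_right h6
      (show 0 ≤ b ^ 2 * (logFactor a * Real.log T) by positivity)
    linarith
  set Q := |Δ| / (m * Real.log 2) + (c' * (b / √a) + K / m) * (b ^ 2 * logFactor a) with hQ
  have hQ0 : 0 ≤ Q := by positivity
  set D := ∑ t ∈ Finset.Icc 1 T, d t with hDdef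
  have h8 : (1 / T : ℝ) * D ≤ √((T : ℝ) + a) / (c * b * T) * (Q * (C * Real.log T)
      + B * (b * (1 / √a + 2 * √(T + a)))) := by
    have e : (1 / T : ℝ) * D = √((T : ℝ) + a) / (c * b * T) * (stepSize a b T * (c * D)) := by
      rw [stepSize]
      field_simp
    rw [e]
    gcongr
  have h9 : √((T : ℝ) + a) / (c * b * T) ≤ √(1 + a) / (c * b * √T) := by
    rw [div_le_div_iff₀ (by positivity) (by positivity)]
    have := mul_le_mul_of_nonneg_right hs (show 0 ≤ c * b * √(T : ℝ) by positivity)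
    calc _ ≤ _ := this
      _ = √(1 + a) * (c * b * (√(T : ℝ) * √(T : ℝ))) := by ring
      _ = _ := by rw [hss]
  refine h8.trans ?_
  rw [mul_add]
  have hlT0 : 0 ≤ Real.log T := hl2.le.trans hlT
  refine add_le_add ?_ ?_
  · calc _ ≤ √(1 + a) / (c * b * √T) * (Q * (C * Real.log T)) := by gcongr
      _ = _ := by field_simp
  · have e1 : 1 / √a + 2 * √((T : ℝ) + a) ≤ √T * (1 / √a + 2 * √(1 + a)) := by
      have : 1 / √a ≤ √T * (1 / √a) := le_mul_of_one_le_left (by positivity) hsT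
      linarith
    calc _ ≤ √(1 + a) / (c * b * √T) * (B * (b * (√T * (1 / √a + 2 * √(1 + a))))) := by gcongr
      _ = _ := by field_simp

end rate

/-! ### Descent along the average trajectory -/

section descent

variable {N n : ℕ} {Ω : Type*} [MeasurableSpace Ω] {Pr : Measure Ω}
  {x y g : ℕ → Fin N → Ω → Vec n} {η : ℕ → ℝ} {I : Set ℕ} {W : Matrix (Fin N) (Fin N) ℝ}
  {G : Digraph (Fin N)} {γ p q D : ℝ}

theorem IsMixingMatrix.avg_succ (hW : IsMixingMatrix G W)
    (h : IsTrajectory Pr W γ p q D η I x y g) (t : ℕ) (ω : Ω) :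
    (avg fun i => x (t + 1) i ω) = (avg fun i => x t i ω) + η t • avg fun i => g t i ω := by
  rw [← avg_smul]
  by_cases ht : t + 1 ∈ I
  · exact hW.avg_round fun i => h.step_comm t ht i ω
  · simp_rw [h.step_local t ht]
    exact avg_add _ _

variable {F : Fin N → Vec n → Vec n} {L P ζ β : ℝ}

theorem memLp_comp_of_lipschitz [IsFiniteMeasure Pr] {f : Vec n → Vec n}
    (hf : ∀ x y, ‖f x - f y‖ ≤ L * ‖x - y‖) {X : Ω → Vec n} (hX : MemLp X 2 Pr) :
    MemLp (fun ω => f (X ω)) 2 Pr := by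
  have h : MemLp (fun ω => ‖f 0‖ + L * ‖X ω‖) 2 Pr := (memLp_const ‖f 0‖).add (hX.norm.const_mul L)
  refine h.mono' ((continuous_of_dist_le hf).comp_aestronglyMeasurable hX.1)
    (.of_forall fun ω => ?_)
  have h1 := hf (X ω) 0
  rw [sub_zero] at h1
  have h2 := norm_add_le (f (X ω) - f 0) (f 0)
  rw [sub_add_cancel] at h2
  linarith

theorem integral_norm_avg_sq_le (hN : 1 ≤ N) (h : IsTrajectory Pr W γ p q D η I x y g) (t : ℕ) :
    ∫ ω, ‖avg fun i => g t i ω‖ ^ 2 ∂Pr ≤ D ^ 2 := by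
  have hN' : (0 : ℝ) < N := by positivity
  calc ∫ ω, ‖avg fun i => g t i ω‖ ^ 2 ∂Pr
      ≤ ∫ ω, (1 / N : ℝ) * ∑ i, ‖g t i ω‖ ^ 2 ∂Pr :=
        integral_mono ((memLp_avg (h.memLp_g t)).integrable_norm_pow two_ne_zero)
          ((integrable_sum_norm_sq (h.memLp_g t)).const_mul _) fun ω => norm_avg_sq_le hN _
    _ = (1 / N : ℝ) * ∑ i, ∫ ω, ‖g t i ω‖ ^ 2 ∂Pr := by
        rw [integral_const_mul, integral_finsetSum _ fun i _ =>
          (h.memLp_g t i).integrable_norm_pow two_ne_zero]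
    _ ≤ (1 / N : ℝ) * ∑ _i : Fin N, D ^ 2 := by
        gcongr with i
        exact h.increment_le t i
    _ = D ^ 2 := by
        rw [Finset.sum_const, Finset.card_univ, Fintype.card_fin, nsmul_eq_mul]
        field_simp

theorem integral_inner_avg_congr {U : Ω → Vec n} {u v : Fin N → Ω → Vec n}
    (hu : ∀ i, Integrable (fun ω => ⟪U ω, u i ω⟫_ℝ) Pr)
    (hv : ∀ i, Integrable (fun ω => ⟪U ω, v i ω⟫_ℝ) Pr)
    (huv : ∀ i, ∫ ω, ⟪U ω, u i ω⟫_ℝ ∂Pr = ∫ ω, ⟪U ω, v i ω⟫_ℝ ∂Pr) :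
    ∫ ω, ⟪U ω, avg fun i => u i ω⟫_ℝ ∂Pr = ∫ ω, ⟪U ω, avg fun i => v i ω⟫_ℝ ∂Pr := by
  simp_rw [inner_avg]
  rw [integral_const_mul, integral_const_mul, integral_finsetSum _ fun i _ => hu i,
    integral_finsetSum _ fun i _ => hv i]
  simp_rw [huv]

/-- The fixed point residual of the global operator at the average of the agents. -/
def avgResidual (F : Fin N → Vec n → Vec n) (x : ℕ → Fin N → Ω → Vec n) (t : ℕ) (ω : Ω) : Vec n :=
  (avg fun i => x t i ω) - globalOp F (avg fun i => x t i ω)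

variable [IsProbabilityMeasure Pr]

theorem memLp_avgResidual (hN : 1 ≤ N) (hF : ∀ i x y, ‖F i x - F i y‖ ≤ L * ‖x - y‖)
    (h : IsTrajectory Pr W γ p q D η I x y g) (t : ℕ) : MemLp (avgResidual F x t) 2 Pr :=
  (memLp_avg (h.memLp_x t)).sub
    (memLp_comp_of_lipschitz (globalOp_lipschitz hN hF) (memLp_avg (h.memLp_x t)))

/-- The average moves by `η_t` times the mean increment, so the descent lemma applies to it. Here
`m` stands for the increment with its sample integrated out: the bias bound holds for `m` pointwise
but for `g` only on average. -/
theorem IsMixingMatrix.expected_descent (hW : IsMixingMatrix G W) (hN : 1 ≤ N) (hL : 0 ≤ L)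
    (hP0 : 0 ≤ P) (hP1 : P < 1) (hη : ∀ t, 0 ≤ η t)
    (hF : ∀ i x y, ‖F i x - F i y‖ ≤ L * ‖x - y‖) (hζ : BoundedHeterogeneity F ζ)
    {Φ : Vec n → ℝ} (hΦ : ∀ x, HasGradientAt Φ (globalOp F x) x)
    (h : IsTrajectory Pr W γ p q D η I x y g) {t : ℕ} {m : Fin N → Ω → Vec n}
    (hm : ∀ i ω, ‖m i ω - (F i (x t i ω) - x t i ω)‖ ^ 2
      ≤ β ^ 2 + P * ‖F i (x t i ω) - x t i ω‖ ^ 2)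
    (hmi : ∀ i, Integrable (fun ω => ⟪avgResidual F x t ω, m i ω⟫_ℝ) Pr)
    (hmg : ∀ i, ∫ ω, ⟪avgResidual F x t ω, g t i ω⟫_ℝ ∂Pr
      = ∫ ω, ⟪avgResidual F x t ω, m i ω⟫_ℝ ∂Pr) :
    ∫ ω, residualPotential Φ (avg fun i => x (t + 1) i ω) ∂Pr
      ≤ ∫ ω, residualPotential Φ (avg fun i => x t i ω) ∂Pr
        - η t * ((1 - P) / 8 * ∫ ω, ‖avgResidual F x t ω‖ ^ 2 ∂Pr)
        + η t * ((β ^ 2 + 2 * P * ζ ^ 2) / 2)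
        + η t * ((1 + L) ^ 2 * (4 / (1 - P)) * disagreement Pr x t)
        + (1 + L) * D ^ 2 * η t ^ 2 := by
  have hFL := globalOp_lipschitz hN hF
  have hres := memLp_avgResidual hN hF h t
  have hgavg := memLp_avg (h.memLp_g t)
  have hpot := fun t => integrable_residualPotential_comp hL hΦ hFL (memLp_avg (h.memLp_x t))
  have h1 : ∫ ω, residualPotential Φ (avg fun i => x (t + 1) i ω) ∂Pr
      ≤ 1 * ∫ ω, residualPotential Φ (avg fun i => x t i ω) ∂Pr
        + η t * ∫ ω, ⟪avgResidual F x t ω, avg fun i => g t i ω⟫_ℝ ∂Pr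
        + (1 + L) * η t ^ 2 * ∫ ω, ‖avg fun i => g t i ω‖ ^ 2 ∂Pr := by
    refine integral_le_linear_comb (hpot (t + 1)) (hpot t) (integrable_inner_of_memLp hres hgavg)
      (hgavg.integrable_norm_pow two_ne_zero) fun ω => ?_
    have := (abs_le.1 (abs_residualPotential_sub_le hL hΦ hFL (avg fun i => x t i ω)
      (η t • avg fun i => g t i ω))).2
    rw [inner_smul_right, norm_smul, mul_pow, Real.norm_eq_abs, sq_abs] at this
    rw [hW.avg_succ h, avgResidual]
    linarith
  have h2 : ∫ ω, ⟪avgResidual F x t ω, avg fun i => m i ω⟫_ℝ ∂Pr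
      ≤ (β ^ 2 + 2 * P * ζ ^ 2) / 2 * ∫ _, (1 : ℝ) ∂Pr
        + -((1 - P) / 8) * ∫ ω, ‖avgResidual F x t ω‖ ^ 2 ∂Pr
        + (1 + L) ^ 2 * (4 / (1 - P)) * disagreement Pr x t := by
    refine integral_le_linear_comb ?_ (integrable_const 1) (hres.integrable_norm_pow two_ne_zero)
      (integrable_sum_norm_sq (memLp_sub_avg (h.memLp_x t))) fun ω => ?_
    · simp_rw [inner_avg]
      exact (integrable_finsetSum _ fun i _ => hmi i).const_mul _
    · have h3 := inner_avg_increment_le hN hP0 hP1 hF hζ (fun i => x t i ω) (fun i => m i ω)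
        (avg fun i => x t i ω) fun i => hm i ω
      have hN' : (1 : ℝ) ≤ N := by exact_mod_cast hN
      have h4 : (1 / N : ℝ) * ∑ i, ‖x t i ω - avg fun i => x t i ω‖ ^ 2
          ≤ ∑ i, ‖x t i ω - avg fun i => x t i ω‖ ^ 2 :=
        mul_le_of_le_one_left (Finset.sum_nonneg fun i _ => by positivity)
          (div_le_one_of_le₀ hN' (by positivity))
      have hP2 : 0 < 1 - P := by linarith
      have h5 := mul_le_mul_of_nonneg_left h4
        (show 0 ≤ (1 + L) ^ 2 * (4 / (1 - P)) by positivity)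
      rw [avgResidual]
      linarith
  -- The pointwise estimate was made for `m`; in expectation it transfers to the actual increments.
  rw [← integral_inner_avg_congr (fun i => integrable_inner_of_memLp hres (h.memLp_g t i)) hmi hmg]
    at h2
  rw [integral_const, probReal_univ, one_smul, mul_one] at h2
  have h3 := mul_le_mul_of_nonneg_left h2 (hη t)
  have h4 := mul_le_mul_of_nonneg_left (integral_norm_avg_sq_le hN h t)
    (show 0 ≤ (1 + L) * η t ^ 2 by positivity)
  linarith

theorem sum_integral_residual_le (hN : 1 ≤ N) (hF : ∀ i x y, ‖F i x - F i y‖ ≤ L * ‖x - y‖)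
    (h : IsTrajectory Pr W γ p q D η I x y g) (t : ℕ) :
    (1 / N : ℝ) * ∑ i, ∫ ω, ‖x t i ω - globalOp F (x t i ω)‖ ^ 2 ∂Pr
      ≤ 2 * ∫ ω, ‖avgResidual F x t ω‖ ^ 2 ∂Pr + 2 * (1 + L) ^ 2 * disagreement Pr x t := by
  have hN' : (1 : ℝ) ≤ N := by exact_mod_cast hN
  have hFL := globalOp_lipschitz hN hF
  have hres := memLp_avgResidual hN hF h t
  have hd : ∀ i, Integrable (fun ω => ‖x t i ω - avg fun j => x t j ω‖ ^ 2) Pr := fun i =>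
    (memLp_sub_avg (h.memLp_x t) i).integrable_norm_pow two_ne_zero
  have hi : ∀ i, ∫ ω, ‖x t i ω - globalOp F (x t i ω)‖ ^ 2 ∂Pr
      ≤ 2 * ∫ ω, ‖avgResidual F x t ω‖ ^ 2 ∂Pr
        + 2 * (1 + L) ^ 2 * ∫ ω, ‖x t i ω - avg fun j => x t j ω‖ ^ 2 ∂Pr
        + 0 * ∫ _, (0 : ℝ) ∂Pr := by
    intro i
    have hx : MemLp (fun ω => x t i ω - globalOp F (x t i ω)) 2 Pr :=
      (h.memLp_x t i).sub (memLp_comp_of_lipschitz hFL (h.memLp_x t i))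
    refine integral_le_linear_comb (hx.integrable_norm_pow two_ne_zero)
      (hres.integrable_norm_pow two_ne_zero) (hd i) (integrable_const 0) fun ω => ?_
    have h1 := norm_add_sq_le_two (avgResidual F x t ω)
      ((x t i ω - globalOp F (x t i ω)) - avgResidual F x t ω)
    rw [add_sub_cancel] at h1
    have h2 := pow_le_pow_left₀ (norm_nonneg _)
      (residual_lipschitz hFL (x t i ω) (avg fun j => x t j ω)) 2
    rw [mul_pow] at h2
    rw [avgResidual] at h1 ⊢
    linarith
  have hsum : ∑ i, ∫ ω, ‖x t i ω - avg fun j => x t j ω‖ ^ 2 ∂Pr = disagreement Pr x t := by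
    rw [disagreement, integral_finsetSum _ fun i _ => hd i]
  calc (1 / N : ℝ) * ∑ i, ∫ ω, ‖x t i ω - globalOp F (x t i ω)‖ ^ 2 ∂Pr
      ≤ (1 / N : ℝ) * ∑ i, (2 * ∫ ω, ‖avgResidual F x t ω‖ ^ 2 ∂Pr
        + 2 * (1 + L) ^ 2 * ∫ ω, ‖x t i ω - avg fun j => x t j ω‖ ^ 2 ∂Pr) := by
        gcongr with i
        have := hi i
        rwa [zero_mul, add_zero] at this
    _ = 2 * ∫ ω, ‖avgResidual F x t ω‖ ^ 2 ∂Pr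
        + (1 / N : ℝ) * (2 * (1 + L) ^ 2 * disagreement Pr x t) := by
        rw [Finset.sum_add_distrib, Finset.sum_const, Finset.card_univ, Fintype.card_fin,
          nsmul_eq_mul, ← Finset.mul_sum, hsum]
        field_simp
    _ ≤ _ := by
        have := disagreement_nonneg Pr x t
        refine add_le_add le_rfl (mul_le_of_le_one_left (by positivity) ?_)
        exact div_le_one_of_le₀ hN' (by positivity)

/-- The ergodic rate of the fixed point residual, given the consensus estimate. -/
theorem IsMixingMatrix.average_residual_le (hW : IsMixingMatrix G W) (hN : 1 ≤ N) (hL : 0 ≤ L)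
    (hP0 : 0 ≤ P) (hP1 : P < 1) {a b C Δ : ℝ} (ha : 0 < a) (hb : 0 < b) (hD : 0 < D)
    (hDC : 8 * D ^ 2 ≤ C)
    (hF : ∀ i x y, ‖F i x - F i y‖ ≤ L * ‖x - y‖) (hζ : BoundedHeterogeneity F ζ)
    {Φ : Vec n → ℝ} (hΦ : ∀ x, HasGradientAt Φ (globalOp F x) x)
    (hΔ : ∀ y, -Δ ≤ surrogate (globalOp F) 0 y)
    (h : IsTrajectory Pr W γ p q D (stepSize a b) I x y g)
    (hcons : ∀ t, disagreement Pr x t ≤ C * stepSize a b t ^ 2) {m : ℕ → Fin N → Ω → Vec n}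
    (hm : ∀ t i ω, ‖m t i ω - (F i (x t i ω) - x t i ω)‖ ^ 2
      ≤ β ^ 2 + P * ‖F i (x t i ω) - x t i ω‖ ^ 2)
    (hmi : ∀ t i, Integrable (fun ω => ⟪avgResidual F x t ω, m t i ω⟫_ℝ) Pr)
    (hmg : ∀ t i, ∫ ω, ⟪avgResidual F x t ω, g t i ω⟫_ℝ ∂Pr
      = ∫ ω, ⟪avgResidual F x t ω, m t i ω⟫_ℝ ∂Pr) {T : ℕ} (hT : 2 ≤ T) :
    (1 / T : ℝ) * ∑ t ∈ Finset.Icc 1 T,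
        (1 / N : ℝ) * ∑ i, ∫ ω, ‖x t i ω - globalOp F (x t i ω)‖ ^ 2 ∂Pr
      ≤ (2 * (√(1 + a) / ((1 - P) / 8 * b) * (|Δ| / (8 * D ^ 2 * Real.log 2)
          + ((1 + L) ^ 2 * (4 / (1 - P)) * (b / √a) + (1 + L) * D ^ 2 / (8 * D ^ 2))
            * (b ^ 2 * logFactor a)))
          + 2 * (1 + L) ^ 2 * (b ^ 2 * logFactor a)) * (C * Real.log T / √T)
        + 2 * (√(1 + a) / ((1 - P) / 8) * (1 / √a + 2 * √(1 + a)))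
          * ((β ^ 2 + 2 * P * ζ ^ 2) / (P + 1)) := by
  have hP2 : 0 < 1 - P := by linarith
  have hFL := globalOp_lipschitz hN hF
  have hpot := fun t => integrable_residualPotential_comp hL hΦ hFL (memLp_avg (h.memLp_x t))
  have hlow : ∀ t, ∫ ω, residualPotential Φ (avg fun i => x 0 i ω) ∂Pr
      - ∫ ω, residualPotential Φ (avg fun i => x t i ω) ∂Pr ≤ Δ := by
    intro t
    have h0 : ∀ ω, (avg fun i => x 0 i ω) = 0 := fun ω => by simp [h.x_zero, avg]
    rw [← integral_sub (hpot 0) (hpot t)]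
    have h1 : ∀ ω, residualPotential Φ (avg fun i => x 0 i ω)
        - residualPotential Φ (avg fun i => x t i ω) ≤ Δ := by
      intro ω
      have := hΔ (avg fun i => x t i ω)
      rw [surrogate_eq_sub hΦ (continuous_of_dist_le hFL)] at this
      rw [h0]
      linarith
    refine (integral_mono ((hpot 0).sub (hpot t)) (integrable_const Δ) h1).trans_eq ?_
    simp
  have h1 := average_le_of_descent
    (f := fun t => ∫ ω, residualPotential Φ (avg fun i => x t i ω) ∂Pr)
    (d := fun t => ∫ ω, ‖avgResidual F x t ω‖ ^ 2 ∂Pr) ha hb (show 0 < (1 - P) / 8 by positivity)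
    (show 0 ≤ (1 + L) ^ 2 * (4 / (1 - P)) by positivity)
    (show 0 ≤ (β ^ 2 + 2 * P * ζ ^ 2) / 2 by positivity) (show 0 < 8 * D ^ 2 by positivity) hDC
    (show 0 ≤ (1 + L) * D ^ 2 by positivity)
    (fun t => integral_nonneg fun ω => sq_nonneg ‖avgResidual F x t ω‖)
    (fun t => hW.expected_descent hN hL hP0 hP1 (fun t => (stepSize_pos ha hb t).le) hF hζ hΦ h
      (hm t) (hmi t) (hmg t)) hcons hlow hT
  have hT' : (2 : ℝ) ≤ T := by exact_mod_cast hT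
  have hT0 : (0 : ℝ) < T := by linarith
  have hC : 0 ≤ C := le_trans (by positivity) hDC
  have hlT : 0 ≤ Real.log T := Real.log_nonneg (by linarith)
  have hlf := logFactor_pos ha
  have h2 : (1 / T : ℝ) * ∑ t ∈ Finset.Icc 1 T, disagreement Pr x t
      ≤ b ^ 2 * logFactor a * (C * Real.log T / √T) := by
    have h3 : ∑ t ∈ Finset.Icc 1 T, disagreement Pr x t
        ≤ C * (b ^ 2 * (logFactor a * Real.log T)) := by
      calc _ ≤ ∑ t ∈ Finset.Icc 1 T, C * stepSize a b t ^ 2 :=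
            Finset.sum_le_sum fun t _ => hcons t
        _ = C * ∑ t ∈ Finset.Icc 1 T, stepSize a b t ^ 2 := (Finset.mul_sum _ _ _).symm
        _ ≤ C * (b ^ 2 * Real.log (1 + T / a)) := by
            gcongr
            exact sum_stepSize_sq_Icc_le ha T
        _ ≤ _ := by
            gcongr
            have : 0 < 1 / a := by positivity
            linarith [log_one_add_div_le ha hT]
    have h4 : (1 / T : ℝ) ≤ 1 / √T := by
      have hsT : 1 ≤ √(T : ℝ) := Real.one_le_sqrt.2 (by linarith)
      have hss : √(T : ℝ) * √(T : ℝ) = T := Real.mul_self_sqrt hT0.le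
      refine one_div_le_one_div_of_le (by linarith) ?_
      nlinarith
    calc _ ≤ 1 / √T * (C * (b ^ 2 * (logFactor a * Real.log T))) :=
          mul_le_mul h4 h3 (Finset.sum_nonneg fun t _ => disagreement_nonneg Pr x t) (by positivity)
      _ = _ := by ring
  have h5 : (1 / T : ℝ) * ∑ t ∈ Finset.Icc 1 T,
        (1 / N : ℝ) * ∑ i, ∫ ω, ‖x t i ω - globalOp F (x t i ω)‖ ^ 2 ∂Pr
      ≤ 2 * ((1 / T : ℝ) * ∑ t ∈ Finset.Icc 1 T, ∫ ω, ‖avgResidual F x t ω‖ ^ 2 ∂Pr)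
        + 2 * (1 + L) ^ 2 * ((1 / T : ℝ) * ∑ t ∈ Finset.Icc 1 T, disagreement Pr x t) := by
    refine (mul_le_mul_of_nonneg_left
      (Finset.sum_le_sum fun t (_ : t ∈ Finset.Icc 1 T) => sum_integral_residual_le hN hF h t)
      (show (0 : ℝ) ≤ 1 / T by positivity)).trans_eq ?_
    rw [Finset.sum_add_distrib, ← Finset.mul_sum, ← Finset.mul_sum]
    ring
  -- The stated denominator is weaker because `P + 1 ≤ 2`.
  have h6 : (β ^ 2 + 2 * P * ζ ^ 2) / 2 ≤ (β ^ 2 + 2 * P * ζ ^ 2) / (P + 1) := by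
    gcongr
    linarith
  have h7 := mul_le_mul_of_nonneg_left h6
    (show 0 ≤ √(1 + a) / ((1 - P) / 8) * (1 / √a + 2 * √(1 + a)) by positivity)
  have h8 := mul_le_mul_of_nonneg_left h2 (show 0 ≤ 2 * (1 + L) ^ 2 by positivity)
  linarith

end descent

end DistKM

end

/-! ### The main theorem: choice of constants and assembly -/

theorem theorem1
    (L P M a b : ℝ) (hL : 0 < L) (hP0 : 0 ≤ P) (hP1 : P < 1) (hM : 0 ≤ M)
    (hb0 : 0 < b) (hb : b ≤ (1 - P) * √a / (6 * (1 + L) * (1 + 4 * M))) :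
    -- the constant of the bias term depends on `L, P, M, a, b` only
    ∃ K₂ : ℝ, 0 < K₂ ∧
    ∀ (σ ζ D Δ : ℝ), 0 ≤ σ → 0 ≤ ζ → 0 < D →
    -- the constant of the vanishing term depends on `L, P, M, a, b, σ, ζ, D, Δ` only
    ∃ K₁ : ℝ, 0 < K₁ ∧
    ∀ (N n H : ℕ) (_ : 1 ≤ N) (β r φ δ γ ψ : ℝ)
      -- network
      (G : Digraph (Fin N)) (W : Matrix (Fin N) (Fin N) ℝ)
      (_ : StronglyConnected G) (_ : IsMixingMatrix G W)
      -- operators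
      (F : Fin N → Vec n → Vec n)
      (_ : ∀ i x y, ‖F i x - F i y‖ ≤ L * ‖x - y‖)
      (_ : ∀ i, IsConservative (F i))
      (_ : (Function.fixedPoints (globalOp F)).Nonempty)
      (_ : BoundedHeterogeneity F ζ)
      -- oracles
      (Ξ : Fin N → Type*) [∀ i, MeasurableSpace (Ξ i)]
      (μ : (i : Fin N) → Measure (Ξ i)) [∀ i, IsProbabilityMeasure (μ i)]
      (Ft : (i : Fin N) → Vec n → Ξ i → Vec n) (_ : 0 ≤ β)
      (_ : ∀ i, IsBiasedOracle (μ i) (F i) (Ft i) β P σ M D)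
      -- compressor
      (Θ : Type*) [MeasurableSpace Θ] (ν : Measure Θ) [IsProbabilityMeasure ν]
      (C : Vec n → Θ → Vec n) (_ : 0 < r) (_ : 0 < φ) (_ : φ ≤ 1) (_ : 0 ≤ δ)
      (_ : IsCompressor ν C r φ δ)
      -- communication times and randomness
      (I : Set ℕ) (_ : IsSchedule I H)
      (Ω : Type*) [MeasurableSpace Ω] (Pr : Measure Ω) [IsProbabilityMeasure Pr]
      (ξ : ℕ → (i : Fin N) → Ω → Ξ i) (θ : ℕ → Fin N → Ω → Θ)
      (_ : IsFreshNoise Pr μ ν ξ θ)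
      -- parameters of the algorithm
      (_ : 3 / (4 * r) < ψ) (_ : ψ ≤ 1 / r)
      (_ : GammaAdmissible (netKappa W) (netAlpha W) φ ψ r γ)
      (_ : 4 * H / (3 * zetaOne (netKappa W) (netAlpha W) φ ψ r γ) < a),
      let x : ℕ → Fin N → Ω → Vec n := fun t i ω =>
        (run W γ ψ (stepSize a b) (stepSize a b) I Ft C ξ θ t ω).x i
      let xbar : ℕ → Ω → Vec n := fun t ω => avg fun i => x t i ω
      let C₁ : ℝ := consensusConst N H (netKappa W) (netAlpha W) φ ψ r γ δ D
      0 < C₁ ∧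
      (∀ t i, Integrable (fun ω => ‖x t i ω - xbar t ω‖ ^ 2) Pr) ∧
      (∀ t i, Integrable (fun ω => ‖x t i ω - globalOp F (x t i ω)‖ ^ 2) Pr) ∧
      (∀ T : ℕ, 1 ≤ T →
        ∑ t ∈ Finset.Icc 1 T, ∑ i, ∫ ω, ‖x t i ω - xbar t ω‖ ^ 2 ∂Pr
          ≤ C₁ * b ^ 2 * Real.log (1 + T / a)) ∧
      -- the surrogate function is bounded below
      ((∀ y, -Δ ≤ surrogate (globalOp F) 0 y) →
        ∀ T : ℕ, 2 ≤ T →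
          (1 / T : ℝ) * ∑ t ∈ Finset.Icc 1 T,
              (1 / N : ℝ) * ∑ i, ∫ ω, ‖x t i ω - globalOp F (x t i ω)‖ ^ 2 ∂Pr
            ≤ K₁ * (C₁ * Real.log T / √T) + K₂ * ((β ^ 2 + 2 * P * ζ ^ 2) / (P + 1))) := by
  -- `a > 0` is implicit in the bound on `b`: otherwise `√a = 0` would force `b ≤ 0`.
  have hsa : 0 < √a := by
    by_contra hneg
    have h0 : √a = 0 := le_antisymm (not_lt.1 hneg) (Real.sqrt_nonneg a)
    rw [h0, mul_zero, zero_div] at hb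
    exact absurd hb0 (not_lt.2 hb)
  have ha0 : 0 < a := Real.sqrt_pos.1 hsa
  have hP2 : 0 < 1 - P := by linarith
  have hlf := logFactor_pos ha0
  have hl2 : 0 < Real.log 2 := Real.log_pos one_lt_two
  refine ⟨2 * (√(1 + a) / ((1 - P) / 8) * (1 / √a + 2 * √(1 + a))), by positivity, ?_⟩
  intro σ ζ D Δ _ _ hD
  refine ⟨2 * (√(1 + a) / ((1 - P) / 8 * b) * (|Δ| / (8 * D ^ 2 * Real.log 2)
      + ((1 + L) ^ 2 * (4 / (1 - P)) * (b / √a) + (1 + L) * D ^ 2 / (8 * D ^ 2))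
        * (b ^ 2 * logFactor a))) + 2 * (1 + L) ^ 2 * (b ^ 2 * logFactor a), by positivity, ?_⟩
  intro N n H hN β r φ δ γ ψ G W _ hW F hF hcons _ hζ Ξ _ μ _ Ft _ hFt Θ _ ν _ C hr hφ0 hφ1 _ hC
    I hI Ω _ Pr _ ξ θ hnoise hψ0 hψ1 hadm ha x xbar C₁
  obtain ⟨hq0, hq1, hp0, hp1⟩ := scaled_gain_bounds hr hφ0 hψ0 hψ1
  have hψ : 0 ≤ ψ := by
    refine le_trans ?_ hψ0.le
    positivity
  have htraj := hW.isTrajectory_run (γ := γ) (I := I) hFt hC hr hψ hq1 (stepSize_pos ha0 hb0) hnoise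
  have hκ : 0 < netKappa W := kappa_pos_of_admissible hadm hφ0 (hp1.trans hφ1)
  have hα : 0 ≤ netAlpha W := l2Norm_nonneg _
  have hH1 : 1 ≤ H := by
    obtain ⟨u, hu, hu1, hu2⟩ := hI.gap 1 le_rfl
    omega
  have hζ₂ := zetaTwo_pos hN hD hκ hα hadm.1 hφ0 (hp1.trans hφ1)
  have hC8 : 8 * D ^ 2 ≤ C₁ := le_consensusConst hN hH1 hζ₂.le (by linarith)
  have hC0 : 0 < C₁ := lt_of_lt_of_le (by positivity) hC8
  have hdis : ∀ t, disagreement Pr x t ≤ C₁ * stepSize a b t ^ 2 :=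
    hW.disagreement_le hN htraj hI hadm hr hφ0 hφ1 hψ0 hψ1 ha0 hb0 hD ha
  have hFL := globalOp_lipschitz hN hF
  have hxL : ∀ t i, MemLp (x t i) 2 Pr := htraj.memLp_x
  have hdi : ∀ t i, Integrable (fun ω => ‖x t i ω - xbar t ω‖ ^ 2) Pr := fun t i =>
    (memLp_sub_avg (hxL t) i).integrable_norm_pow two_ne_zero
  refine ⟨hC0, hdi, fun t i => ?_, fun T _ => ?_, fun hΔ T hT => ?_⟩
  · have h : MemLp (fun ω => x t i ω - globalOp F (x t i ω)) 2 Pr :=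
      (hxL t i).sub (memLp_comp_of_lipschitz hFL (hxL t i))
    exact h.integrable_norm_pow two_ne_zero
  · have hsum : ∀ t, ∑ i, ∫ ω, ‖x t i ω - xbar t ω‖ ^ 2 ∂Pr = disagreement Pr x t := fun t => by
      rw [disagreement, integral_finsetSum _ fun i _ => hdi t i]
    simp_rw [hsum]
    calc ∑ t ∈ Finset.Icc 1 T, disagreement Pr x t
        ≤ ∑ t ∈ Finset.Icc 1 T, C₁ * stepSize a b t ^ 2 := Finset.sum_le_sum fun t _ => hdis t
      _ = C₁ * ∑ t ∈ Finset.Icc 1 T, stepSize a b t ^ 2 := (Finset.mul_sum _ _ _).symm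
      _ ≤ C₁ * (b ^ 2 * Real.log (1 + T / a)) :=
          mul_le_mul_of_nonneg_left (sum_stepSize_sq_Icc_le ha0 T) hC0.le
      _ = _ := by ring
  · choose Φ hΦ using hcons
    have hmeas := measurable_run (W := W) (γ := γ) (ψ := ψ) (η := stepSize a b)
      (s := stepSize a b) (I := I) (ξ := ξ) (θ := θ) (fun i => (hFt i).measurable) hC.measurable
    have havg : ∀ t, Measurable[history ξ θ t] fun ω => avg fun i => x t i ω := fun t =>
      (Finset.measurable_sum _ fun i _ => (hmeas t).1 i).const_smul (1 / N : ℝ)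
    have hU : ∀ t, Measurable[history ξ θ t] (avgResidual F x t) := fun t =>
      (havg t).sub ((continuous_of_dist_le hFL).measurable.comp (havg t))
    -- The residual at the average depends only on the past, so it is an admissible test vector
    -- against the fresh samples.
    have hswap := fun t i => IsBiasedOracle.integral_inner_increment hFt hnoise (hmeas t).1 (hU t)
      (memLp_avgResidual hN hF htraj t) i
    refine hW.average_residual_le hN hL.le hP0 hP1 ha0 hb0 hD hC8 hF hζ
      (hasGradientAt_globalOp hΦ) hΔ htraj hdis
      (m := fun t i ω => ∫ w, (Ft i (x t i ω) w - x t i ω) ∂(μ i)) (fun t i ω => ?_)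
      (fun t i => (hswap t i).1) (fun t i => (hswap t i).2) hT
    rw [integral_sub (((hFt i).memLp _).integrable one_le_two) (integrable_const _),
      integral_const, probReal_univ, one_smul, sub_sub_sub_cancel_right]
    exact (hFt i).bias _
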